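/- Let $0\le d\le n$ be integers and let $h:(0,+\infty)\to[0,+\infty]$ be a gauge function, i.e. $h$ is nondecreasing and $\lim_{r\to 0^+}h(r)=0$. Let $B(x,r)$ and $\overline B(x,r)$ denote open and closed balls in $\mathbb R^n$, and $\mathcal H^d$ the $d$-dimensional Hausdorff measure, normalized to agree with Lebesgue measure on $\mathbb R^d$. Let $U\subset\mathbb R^n$ be open. A set $E\subset U$, closed in $U$ and with $\mathcal H^d(E\cap K)<+\infty$ for every compact $K\subset U$, is called (plain) almost minimal in $U$, of dimension $d$ and with gauge function $h$, if $$\mathcal H^d(E\cap B)\le \mathcal H^d(\varphi_1(E)\cap B)+h(r)\,r^d$$ for every closed ball $B=\overline B(x,r)\subset U$ with $r>0$ and every family $\varphi_t:E\to\mathbb R^n$, $0\le t\le 1$, such that $(y,t)\mapsto\varphi_t(y)$ is continuous on $E\times[0,1]$, $\varphi_0(y)=y$ for $y\in E$, $\varphi_t(y)=y$ for $y\in E\setminus B$ and $0\le t\le1$, $\varphi_t(E\cap B)\subset B$ for $0\le t\le 1$, and $\varphi_1$ is Lipschitz. It is called coral if $\mathcal H^d(E\cap B(x,r))>0$ for all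 $x\in E$ and $r>0$. Theorem 4.35. For each $\tau>0$ there exist $\varepsilon>0$ and $r_0>0$, depending only on $n$, $d$, $h$ and $\tau$, such that the following holds. Let $U\subset\mathbb R^n$ be open and let $E$ be a coral almost minimal set of dimension $d$ in $U$, with gauge function $h$. Let $x\in E$ and $r\in(0,r_0]$ be such that $B(x,2r)\subset U$, let $P$ be an affine $d$-plane through $x$, and suppose that $$\operatorname{dist}(y,P)\le\varepsilon r\quad\text{for all } y\in E\cap B(x,r).$$ Let $\pi_P$ denote the orthogonal projection onto $P$. Then $$\pi_P(E\cap B(x,r))\supset P\cap B(x,(1-\tau)r).$$ -/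

import Mathlib

open Set Filter Topology MeasureTheory
open scoped ENNReal NNReal

/-- A gauge function: a nondecreasing `h : (0, ∞) → [0, ∞]` with `h(r) → 0` as `r → 0⁺`
(the values of `h` outside `(0, ∞)` are irrelevant). -/
def IsGauge (h : ℝ → ℝ≥0∞) : Prop :=
  MonotoneOn h (Ioi 0) ∧ Tendsto h (𝓝[>] 0) (𝓝 0)

/-- `φ t`, `0 ≤ t ≤ 1`, is a sliding deformation for `E` in the set `B` (a closed ball in the
applications), with respect to the sliding boundary `Γ`.
Only the values `φ t y` with `t ∈ [0, 1]` and `y ∈ E` matter, and no bound on the Lipschitz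
constant of `φ 1` is required. -/
structure IsSlidingDeformation {n : ℕ} (Γ E B : Set (EuclideanSpace ℝ (Fin n)))
    (φ : ℝ → EuclideanSpace ℝ (Fin n) → EuclideanSpace ℝ (Fin n)) : Prop where
  continuousOn : ContinuousOn (fun p : EuclideanSpace ℝ (Fin n) × ℝ => φ p.2 p.1)
    (E ×ˢ Icc (0 : ℝ) 1)
  start : ∀ y ∈ E, φ 0 y = y
  eq_self : ∀ t ∈ Icc (0 : ℝ) 1, ∀ y ∈ E \ B, φ t y = y
  mapsTo : ∀ t ∈ Icc (0 : ℝ) 1, ∀ y ∈ E ∩ B, φ t y ∈ B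
  sliding : ∀ t ∈ Icc (0 : ℝ) 1, ∀ y ∈ E ∩ Γ, φ t y ∈ Γ
  lipschitz : ∃ K : ℝ≥0, LipschitzOnWith K (φ 1) E

/-- `F` is a sliding competitor for `E` in `B`: the endpoint `φ 1 (E)` of a sliding deformation. -/
def IsSlidingCompetitor {n : ℕ} (Γ E B F : Set (EuclideanSpace ℝ (Fin n))) : Prop :=
  ∃ φ : ℝ → EuclideanSpace ℝ (Fin n) → EuclideanSpace ℝ (Fin n),
    IsSlidingDeformation Γ E B φ ∧ F = φ 1 '' E

/-- `E` is a `d`-dimensional sliding almost minimal set in the open set `U`, with sliding boundary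
`Γ` and gauge function `h`. Here `μHE[d]` is the `d`-dimensional Hausdorff measure, normalized to
agree with Lebesgue measure on `ℝ^d`. -/
structure IsSlidingAlmostMinimal {n : ℕ} (d : ℕ) (Γ U : Set (EuclideanSpace ℝ (Fin n)))
    (h : ℝ → ℝ≥0∞) (E : Set (EuclideanSpace ℝ (Fin n))) : Prop where
  subset : E ⊆ U
  /-- `E` is relatively closed in `U` -/
  closed : closure E ∩ U ⊆ E
  locallyFinite : ∀ K : Set (EuclideanSpace ℝ (Fin n)), IsCompact K → K ⊆ U →
    μHE[d] (E ∩ K) < ∞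
  almostMin : ∀ (x : EuclideanSpace ℝ (Fin n)) (r : ℝ), 0 < r → Metric.closedBall x r ⊆ U →
    ∀ F : Set (EuclideanSpace ℝ (Fin n)), IsSlidingCompetitor Γ E (Metric.closedBall x r) F →
      μHE[d] (E ∩ Metric.closedBall x r) ≤
        μHE[d] (F ∩ Metric.closedBall x r) + h r * ENNReal.ofReal r ^ d

/-- A plain almost minimal set: no boundary constraint, that is, `Γ = ℝ^n`. -/
def IsAlmostMinimal {n : ℕ} (d : ℕ) (U : Set (EuclideanSpace ℝ (Fin n)))
    (h : ℝ → ℝ≥0∞) (E : Set (EuclideanSpace ℝ (Fin n))) : Prop :=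
  IsSlidingAlmostMinimal d univ U h E

/-- `E` is coral (reduced): every point of `E` lies in the closed support of `H^d` restricted
to `E`. -/
def IsCoral {n : ℕ} (d : ℕ) (E : Set (EuclideanSpace ℝ (Fin n))) : Prop :=
  ∀ x ∈ E, ∀ r : ℝ, 0 < r → 0 < μHE[d] (E ∩ Metric.ball x r)

/-!
The proof is by contradiction and compares `E` with explicit competitors, without any compactness
argument. Suppose that a point of `P` is missed by the projection of `E`. It is moved inside `P`
until it is still missed, but `E` has a point nearby; call it `z`, and let `R` be comparable to
`τ r`. Three estimates on the mass of `E` are then incompatible.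

* Decay around the hole (`toReal_le_of_hole`). The part of `E` over a ball of `P` with centre `z` is
  pushed away from `z` to a sphere of dimension `d - 1`, which is a null set. The competitor is the
  identity outside of a slightly larger ball, and it is `4`-Lipschitz over the annulus as soon as
  `E` is closer to `P` than the width of the annulus. Hence the mass over a ball is at most a
  multiple of the mass over the surrounding annulus, up to the gauge. With `N` annuli this
  gives `M(R / 2) ≤ θ ^ N M(R) + η R ^ d`, where `θ < 1`.
* Upper bound (`exists_hausdorffMeasure_le`): `M(R) ≤ C R ^ d`.
* Lower bound (`exists_le_hausdorffMeasure`): `M(R / 2) ≥ c R ^ d`, since `E` is coral and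
  has a point near `z`.

The two bounds rest on a Federer-Fleming deformation to the `k`-skeleton of a cubical grid
(`hausdorffMeasure_le_of_gridMap`), with `k = d` for the upper bound and `k = d - 1` for the lower
one. In the cube `[-1, 1] ^ n`, let `s(y)` be the `(n - k)`-th largest of the numbers `|y i|`. The map
`y ↦ clamp (y / s(y))` is a retraction to the `k`-skeleton off the dual skeleton `{s = 0}`, its
Lipschitz constant is `O(1 / s)`, and replacing `s` by `max s lam`, for a cutoff function `lam`,
interpolates between the retraction (`lam = 0`) and the identity (`lam = 1`).
Since `{s ≤ σ}` has measure `O(σ ^ (k + 1))`, averaging over the translations of the grid, and over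
the position of the cutoff, produces a competitor that expands the mass of the transition
annulus by a bounded factor only. Iterating the resulting inequality over balls with geometrically
decreasing gaps gives the upper bound. If the density of `E` in a ball is small, then for
`k = d - 1` some translated dual skeleton does not meet `E`; the skeleton is now a null set, so
that the density stays small in all smaller balls, and `E` has measure zero near the centre.

The Hausdorff measure is used with Mathlib's normalization `μH[d]`, of which `μHE[d]` is a
multiple.
-/

/-! ### The one-dimensional grid map -/

/-- Twice the distance to the nearest integer, a number in `[0, 1]`. -/
noncomputable def gridDist (t : ℝ) : ℝ := 2 * |t - round t|

/-- The unit cell of centre `round t` is dilated by `1 / σ` about its centre and then clamped to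
itself. For `σ = 1` this is the identity; the points with `σ ≤ gridDist t` go to the ends
of the cell, that is, to half-integers. -/
noncomputable def cellClamp (t σ : ℝ) : ℝ :=
  round t + max (-(1 / 2)) (min (1 / 2) ((t - round t) / σ))

lemma gridDist_nonneg (t : ℝ) : 0 ≤ gridDist t := by unfold gridDist; positivity

lemma gridDist_le_add (t t' : ℝ) : gridDist t ≤ gridDist t' + 2 * |t - t'| := by
  unfold gridDist
  have h1 := round_le t (round t')
  have h2 : |t - round t'| ≤ |t - t'| + |t' - round t'| := abs_sub_le _ _ _
  linarith

lemma cellClamp_one (t : ℝ) : cellClamp t 1 = t := by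
  unfold cellClamp
  have h := abs_le.1 (abs_sub_round t)
  rw [div_one, min_eq_right h.2, max_eq_right h.1]; ring

lemma abs_cellClamp_sub_self_le (t σ : ℝ) : |cellClamp t σ - t| ≤ 1 := by
  unfold cellClamp
  have h := abs_le.1 (abs_sub_round t)
  have h1 : max (-(1 / 2)) (min (1 / 2) ((t - round t) / σ)) ≤ 1 / 2 :=
    max_le (by norm_num) (min_le_left _ _)
  have h2 := le_max_left (-(1 / 2)) (min (1 / 2) ((t - round t) / σ))
  rw [abs_le]; constructor <;> linarith [h.1, h.2]

lemma exists_cellClamp_eq {t σ : ℝ} (hσ : 0 < σ) (h : σ ≤ gridDist t) :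
    ∃ m : ℤ, cellClamp t σ = m + 1 / 2 := by
  unfold gridDist at h
  unfold cellClamp
  rcases le_total 0 (t - round t) with h0 | h0
  · rw [abs_of_nonneg h0] at h
    have : 1 / 2 ≤ (t - round t) / σ := by rw [le_div_iff₀ hσ]; linarith
    exact ⟨round t, by rw [min_eq_left this, max_eq_right (by norm_num)]⟩
  · rw [abs_of_nonpos h0] at h
    have : (t - round t) / σ ≤ -(1 / 2) := by rw [div_le_iff₀ hσ]; linarith
    refine ⟨round t - 1, ?_⟩
    rw [min_eq_right (by linarith), max_eq_left this]
    push_cast; ring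

lemma abs_clamp_sub_le (a b x y : ℝ) : |max a (min b x) - max a (min b y)| ≤ |x - y| := by
  refine (abs_max_sub_max_le_max _ _ _ _).trans (max_le (by simp) ?_)
  exact (abs_min_sub_min_le_max _ _ _ _).trans (max_le (by simp) le_rfl)

lemma cellClamp_sub_le_of_le {t t' σ : ℝ} (hσ : 0 < σ) (hσ1 : σ ≤ 1) (htt : t ≤ t') :
    |cellClamp t σ - cellClamp t' σ| ≤ (t' - t) / σ := by
  have h := abs_le.1 (abs_sub_round t)
  have h' := abs_le.1 (abs_sub_round t')
  have hm : round t ≤ round t' := by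
    rw [round_eq, round_eq]; exact Int.floor_mono (by linarith)
  unfold cellClamp
  set u := t - round t with hu
  set u' := t' - round t' with hu'
  have key : t' - t = (round t' - round t : ℝ) + u' - u := by rw [hu, hu']; ring
  have e1 : (t' - t) / σ = ((round t' - round t : ℝ) - 1) / σ + (1 / 2 + u') / σ
      + (1 / 2 - u) / σ := by rw [key]; ring
  have hdiv : ∀ x : ℝ, 0 ≤ x → x ≤ x / σ := fun x hx => by
    rw [le_div_iff₀ hσ]; nlinarith
  rcases hm.eq_or_lt with hm | hm
  · rw [key, hm]
    have hle : u ≤ u' := by rw [hu, hu', hm]; linarith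
    have hle2 : u / σ ≤ u' / σ := by gcongr
    have e2 : (round t' - round t' + u' - u : ℝ) / σ = u' / σ - u / σ := by ring
    rw [e2, add_sub_add_left_eq_sub]
    calc _ ≤ |u / σ - u' / σ| := abs_clamp_sub_le _ _ _ _
      _ = u' / σ - u / σ := by rw [abs_sub_comm, abs_of_nonneg (by linarith)]
  · have hm1 : (1 : ℝ) ≤ round t' - round t := by
      have : round t + 1 ≤ round t' := hm
      have : ((round t + 1 : ℤ) : ℝ) ≤ round t' := by exact_mod_cast this
      push_cast at this; linarith
    set a := max (-(1 / 2)) (min (1 / 2) (u' / σ))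
    set b := max (-(1 / 2)) (min (1 / 2) (u / σ))
    have ha : a + 1 / 2 ≤ (1 / 2 + u') / σ := by
      have h1 := hdiv (1 / 2) (by norm_num)
      rw [add_div]
      have h3 : 0 ≤ (1 / 2 + u') / σ := div_nonneg (by linarith) hσ.le
      rw [add_div] at h3
      have : a ≤ 1 / 2 / σ + u' / σ - 1 / 2 :=
        max_le (by linarith) ((min_le_right _ _).trans (by linarith))
      linarith
    have hb : 1 / 2 - b ≤ (1 / 2 - u) / σ := by
      have h1 := hdiv (1 / 2) (by norm_num)
      have h3 : 0 ≤ (1 / 2 - u) / σ := div_nonneg (by linarith) hσ.le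
      rw [sub_div] at h3 ⊢
      have : 1 / 2 - (1 / 2 / σ - u / σ) ≤ b :=
        le_max_of_le_right (le_min (by linarith) (by linarith))
      linarith
    have ha0 : -(1 / 2) ≤ a := le_max_left _ _
    have hb0 : b ≤ 1 / 2 := max_le (by norm_num) (min_le_left _ _)
    have h5 := hdiv ((round t' - round t : ℝ) - 1) (by linarith)
    rw [abs_sub_comm, abs_of_nonneg (by linarith), e1]
    linarith

lemma cellClamp_sub_le {t t' σ : ℝ} (hσ : 0 < σ) (hσ1 : σ ≤ 1) :
    |cellClamp t σ - cellClamp t' σ| ≤ |t - t'| / σ := by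
  rcases le_total t t' with h | h
  · rw [abs_sub_comm t t', abs_of_nonneg (sub_nonneg.2 h)]
    exact cellClamp_sub_le_of_le hσ hσ1 h
  · rw [abs_sub_comm, abs_of_nonneg (sub_nonneg.2 h)]
    exact cellClamp_sub_le_of_le hσ hσ1 h

lemma cellClamp_sub_le_right_of_le {t σ σ' : ℝ} (hσ : 0 < σ) (h : σ ≤ σ') :
    |cellClamp t σ - cellClamp t σ'| ≤ (σ' - σ) / σ := by
  unfold cellClamp
  have hσ' : 0 < σ' := hσ.trans_le h
  set u := t - round t
  rw [add_sub_add_left_eq_sub]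
  have hx : u / σ = u / σ' + u / σ' * ((σ' - σ) / σ) := by field_simp; ring
  have hs : 0 ≤ (σ' - σ) / σ := div_nonneg (by linarith) hσ.le
  set x := u / σ'
  set s := (σ' - σ) / σ
  rw [hx]
  rcases le_total 0 x with h0 | h0
  · have h1 : 0 ≤ x * s := mul_nonneg h0 hs
    rw [max_eq_right (le_min (by norm_num) (by linarith)),
      max_eq_right (le_min (by norm_num) (by linarith))]
    rcases le_total (1 / 2) x with h2 | h2
    · rw [min_eq_left h2, min_eq_left (by linarith)]; simpa using hs
    · rw [min_eq_right h2, abs_of_nonneg (by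
        rw [sub_nonneg]; exact le_min h2 (by linarith))]
      have : min (1 / 2) (x + x * s) ≤ x + x * s := min_le_right _ _
      nlinarith
  · have h1 : x * s ≤ 0 := mul_nonpos_of_nonpos_of_nonneg h0 hs
    rw [min_eq_right (by linarith), min_eq_right (by linarith)]
    rcases le_total x (-(1 / 2)) with h2 | h2
    · rw [max_eq_left h2, max_eq_left (by linarith)]; simpa using hs
    · rw [max_eq_right h2, abs_sub_comm, abs_of_nonneg (by
        rw [sub_nonneg]; exact max_le h2 (by linarith))]
      have : x + x * s ≤ max (-(1 / 2)) (x + x * s) := le_max_right _ _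
      nlinarith

lemma cellClamp_sub_le_add {t t' σ σ' σ₀ : ℝ} (hσ₀ : 0 < σ₀) (hσ : σ₀ ≤ σ) (hσ' : σ₀ ≤ σ')
    (hσ1 : σ ≤ 1) :
    |cellClamp t σ - cellClamp t' σ'| ≤ (|t - t'| + |σ - σ'|) / σ₀ := by
  have h1 : |cellClamp t σ - cellClamp t' σ| ≤ |t - t'| / σ₀ :=
    (cellClamp_sub_le (hσ₀.trans_le hσ) hσ1).trans (by gcongr)
  have h2 : |cellClamp t' σ - cellClamp t' σ'| ≤ |σ - σ'| / σ₀ := by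
    rcases le_total σ σ' with h | h
    · refine (cellClamp_sub_le_right_of_le (hσ₀.trans_le hσ) h).trans ?_
      rw [abs_sub_comm σ σ', abs_of_nonneg (sub_nonneg.2 h)]
      have := sub_nonneg.2 h
      gcongr
    · rw [abs_sub_comm]
      refine (cellClamp_sub_le_right_of_le (hσ₀.trans_le hσ') h).trans ?_
      rw [abs_of_nonneg (sub_nonneg.2 h)]
      have := sub_nonneg.2 h
      gcongr
  rw [add_div]
  exact (abs_sub_le _ (cellClamp t' σ) _).trans (add_le_add h1 h2)

/-! ### Distance to the dual skeleton -/

/-- The sup-norm distance (doubled, and truncated at `1`) from `u` to the set of points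
with at least `k + 1` integer coordinates. This set is the skeleton of dimension `n - k - 1` dual to
the `k`-skeleton of the grid with vertices in `(ℤ + 1 / 2) ^ n`. -/
noncomputable def dualDist {n : ℕ} (k : ℕ) (u : Fin n → ℝ) : ℝ :=
  (Finset.powersetCard (k + 1) Finset.univ).fold min 1
    fun I => I.fold max 0 fun i => gridDist (u i)

section dualDist

variable {n k : ℕ} {u u' : Fin n → ℝ}

lemma dualDist_le_iff {σ : ℝ} (hσ : 0 ≤ σ) : dualDist k u ≤ σ ↔
    1 ≤ σ ∨ ∃ I : Finset (Fin n), I.card = k + 1 ∧ ∀ i ∈ I, gridDist (u i) ≤ σ := by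
  simp [dualDist, Finset.fold_min_le, Finset.fold_max_le, Finset.mem_powersetCard, hσ]

lemma dualDist_le_one : dualDist k u ≤ 1 := (dualDist_le_iff zero_le_one).2 (Or.inl le_rfl)

lemma dualDist_nonneg : 0 ≤ dualDist k u := by
  simp [dualDist, Finset.le_fold_min, Finset.le_fold_max]

lemma dualDist_le_add {t : ℝ} (ht : ∀ i, |u i - u' i| ≤ t) (ht0 : 0 ≤ t) :
    dualDist k u ≤ dualDist k u' + 2 * t := by
  rw [dualDist_le_iff (add_nonneg dualDist_nonneg (by linarith))]
  rcases (dualDist_le_iff (u := u') (k := k) dualDist_nonneg).1 le_rfl with h | ⟨I, hI, h⟩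
  · left; linarith
  · right
    exact ⟨I, hI, fun i hi => (gridDist_le_add (u i) (u' i)).trans
      (add_le_add (h i hi) (by linarith [ht i]))⟩

lemma abs_dualDist_sub_le {t : ℝ} (ht : ∀ i, |u i - u' i| ≤ t) (ht0 : 0 ≤ t) :
    |dualDist k u - dualDist k u'| ≤ 2 * t := by
  rw [abs_sub_le_iff]
  constructor
  · linarith [dualDist_le_add (k := k) ht ht0]
  · linarith [dualDist_le_add (k := k) (fun i => (abs_sub_comm (u' i) (u i)).trans_le (ht i)) ht0]

lemma card_filter_lt_dualDist_le :
    (Finset.univ.filter fun i => gridDist (u i) < dualDist k u).card ≤ k := by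
  by_contra! hc
  obtain ⟨I, hI, hcard⟩ := Finset.exists_subset_card_eq (Nat.succ_le_of_lt hc)
  have hlt : ∀ i ∈ I, gridDist (u i) < dualDist k u := fun i hi =>
    (Finset.mem_filter.1 (hI hi)).2
  have hne : I.Nonempty := by rw [← Finset.card_pos, hcard]; omega
  have hmem := Finset.exists_mem_eq_sup' hne (fun i => gridDist (u i))
  obtain ⟨j, hj, hje⟩ := hmem
  have : dualDist k u ≤ gridDist (u j) := by
    rw [dualDist_le_iff (gridDist_nonneg _)]
    right
    refine ⟨I, hcard, fun i hi => ?_⟩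
    rw [← hje]; exact Finset.le_sup' (fun i => gridDist (u i)) hi
  exact absurd (hlt j hj) (not_lt.2 this)

lemma continuous_dualDist : Continuous (dualDist (n := n) k) := by
  refine (LipschitzWith.of_dist_le_mul (K := 2) fun u u' => ?_).continuous
  rw [Real.dist_eq]
  exact abs_dualDist_sub_le (fun i => by rw [← Real.dist_eq]; exact dist_le_pi_dist u u' i)
    dist_nonneg

end dualDist

/-! ### The grid map of Euclidean space -/

section gridMap

variable {n : ℕ}

lemma EuclideanSpace.norm_le_card_mul {x : EuclideanSpace ℝ (Fin n)} {c : ℝ}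
    (h : ∀ i, |x i| ≤ c) : ‖x‖ ≤ n * c := by
  rcases Nat.eq_zero_or_pos n with rfl | hn
  · simp [Subsingleton.elim x 0]
  have hc : 0 ≤ c := (abs_nonneg _).trans (h ⟨0, hn⟩)
  rw [EuclideanSpace.norm_eq]
  refine Real.sqrt_le_iff.2 ⟨by positivity, ?_⟩
  calc ∑ i, ‖x i‖ ^ 2 ≤ ∑ _i : Fin n, c ^ 2 :=
        Finset.sum_le_sum fun i _ => pow_le_pow_left₀ (norm_nonneg _) (h i) 2
    _ = n * c ^ 2 := by simp
    _ ≤ (n * c) ^ 2 := by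
        have : (1 : ℝ) ≤ n := by exact_mod_cast hn
        nlinarith [mul_nonneg (mul_nonneg (by linarith : (0 : ℝ) ≤ n) (sub_nonneg.2 this))
          (sq_nonneg c)]

lemma EuclideanSpace.abs_apply_sub_le (x y : EuclideanSpace ℝ (Fin n)) (i : Fin n) :
    |x i - y i| ≤ dist x y := by
  rw [dist_eq_norm]
  simpa using PiLp.norm_apply_le (x - y) i

/-- Coordinates of `y` with respect to the grid of mesh `δ` translated by `δ v`. -/
noncomputable def gridCoord (δ : ℝ) (v : Fin n → ℝ) (y : EuclideanSpace ℝ (Fin n)) : Fin n → ℝ :=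
  fun i => y i / δ - v i

/-- `cellClamp` applied to all coordinates, in the grid of mesh `δ` translated by `δ v`. With
`σ = dualDist k (gridCoord δ v y)` it is the retraction to the `k`-skeleton, with
`σ = 1` it is the identity. -/
noncomputable def gridMap (δ : ℝ) (v : Fin n → ℝ) (σ : ℝ) (y : EuclideanSpace ℝ (Fin n)) :
    EuclideanSpace ℝ (Fin n) :=
  WithLp.toLp 2 fun i => δ * (cellClamp (gridCoord δ v y i) σ + v i)

/-- The `k`-skeleton of the grid of mesh `δ` translated by `δ v`: all coordinates, except at
most `k` of them, are half-integers. -/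
def gridSkeleton (k : ℕ) (δ : ℝ) (v : Fin n → ℝ) : Set (EuclideanSpace ℝ (Fin n)) :=
  {y | ∃ J : Finset (Fin n), J.card ≤ k ∧ ∀ i ∉ J, ∃ m : ℤ, y i = δ * (m + 1 / 2 + v i)}

lemma gridMap_one {δ : ℝ} (hδ : 0 < δ) (v : Fin n → ℝ) (y : EuclideanSpace ℝ (Fin n)) :
    gridMap δ v 1 y = y := by
  ext i
  simp only [gridMap, cellClamp_one, gridCoord]
  field_simp
  ring

lemma dist_gridMap_self_le {δ : ℝ} (hδ : 0 < δ) (v : Fin n → ℝ) (σ : ℝ)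
    (y : EuclideanSpace ℝ (Fin n)) : dist (gridMap δ v σ y) y ≤ n * δ := by
  rw [dist_eq_norm]
  refine EuclideanSpace.norm_le_card_mul fun i => ?_
  have h := abs_cellClamp_sub_self_le (gridCoord δ v y i) σ
  have : (gridMap δ v σ y - y) i = δ * (cellClamp (gridCoord δ v y i) σ - gridCoord δ v y i) := by
    simp only [PiLp.sub_apply, gridMap, gridCoord]
    field_simp
    ring
  rw [this, abs_mul, abs_of_pos hδ]
  exact mul_le_of_le_one_right hδ.le h

lemma gridMap_mem_gridSkeleton {k : ℕ} {δ : ℝ} {v : Fin n → ℝ} {y : EuclideanSpace ℝ (Fin n)}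
    (h : 0 < dualDist k (gridCoord δ v y)) :
    gridMap δ v (dualDist k (gridCoord δ v y)) y ∈ gridSkeleton k δ v := by
  refine ⟨_, card_filter_lt_dualDist_le (k := k) (u := gridCoord δ v y), fun i hi => ?_⟩
  simp only [Finset.mem_filter, Finset.mem_univ, true_and, not_lt] at hi
  obtain ⟨m, hm⟩ := exists_cellClamp_eq h hi
  exact ⟨m, by simp only [gridMap, hm]⟩

lemma abs_gridCoord_sub_le {δ : ℝ} (hδ : 0 < δ) (v : Fin n → ℝ) (y y' : EuclideanSpace ℝ (Fin n))
    (i : Fin n) : |gridCoord δ v y i - gridCoord δ v y' i| ≤ dist y y' / δ := by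
  simp only [gridCoord]
  rw [sub_sub_sub_cancel_right, ← sub_div, abs_div, abs_of_pos hδ]
  exact div_le_div_of_nonneg_right (EuclideanSpace.abs_apply_sub_le y y' i) hδ.le

lemma dist_gridMap_le {δ σ₀ σ σ' : ℝ} (hδ : 0 < δ) (v : Fin n → ℝ) (hσ₀ : 0 < σ₀) (hσ : σ₀ ≤ σ)
    (hσ' : σ₀ ≤ σ') (hσ1 : σ ≤ 1) (y y' : EuclideanSpace ℝ (Fin n)) :
    dist (gridMap δ v σ y) (gridMap δ v σ' y') ≤
      n * ((dist y y' + δ * |σ - σ'|) / σ₀) := by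
  rw [dist_eq_norm]
  refine EuclideanSpace.norm_le_card_mul fun i => ?_
  have h := cellClamp_sub_le_add (t := gridCoord δ v y i) (t' := gridCoord δ v y' i) hσ₀ hσ hσ' hσ1
  have e : (gridMap δ v σ y - gridMap δ v σ' y') i =
      δ * (cellClamp (gridCoord δ v y i) σ - cellClamp (gridCoord δ v y' i) σ') := by
    simp only [PiLp.sub_apply, gridMap]; ring
  rw [e, abs_mul, abs_of_pos hδ]
  refine (mul_le_mul_of_nonneg_left h hδ.le).trans ?_
  rw [← mul_div_assoc]
  refine div_le_div_of_nonneg_right ?_ hσ₀.le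
  have h2 := abs_gridCoord_sub_le hδ v y y' i
  rw [le_div_iff₀ hδ] at h2
  linarith

end gridMap

/-! ### Averaging over translated grids -/

section averaging

lemma volume_gridDist_sub_le (c : ℝ) {σ : ℝ} (hσ : 0 ≤ σ) :
    volume {t : ℝ | t ∈ Icc (0 : ℝ) 1 ∧ gridDist (c - t) ≤ σ} ≤ ENNReal.ofReal (2 * σ) := by
  have hsub : {t : ℝ | t ∈ Icc (0 : ℝ) 1 ∧ gridDist (c - t) ≤ σ} ⊆
      Icc (c - round c - σ / 2) (c - round c + σ / 2) ∪
        Icc (c - round c + 1 - σ / 2) (c - round c + 1 + σ / 2) := by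
    rintro t ⟨⟨h0, h1⟩, ht⟩
    have hm : ∀ {a b : ℝ}, a ≤ b → round a ≤ round b := fun {a b} h => by
      rw [round_eq, round_eq]; exact Int.floor_mono (by linarith)
    have h2 : round (c - t) ≤ round c := hm (by linarith)
    have h3 : round c - 1 ≤ round (c - t) := by
      rw [← round_sub_one]; exact hm (by linarith)
    have h4 : |c - t - round (c - t)| ≤ σ / 2 := by unfold gridDist at ht; linarith
    rw [abs_le] at h4
    obtain h5 | h5 : round (c - t) = round c ∨ round (c - t) = round c - 1 := by omega
    · rw [h5] at h4
      left; constructor <;> linarith [h4.1, h4.2]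
    · rw [h5] at h4
      push_cast at h4
      right; constructor <;> linarith [h4.1, h4.2]
  refine (measure_mono hsub).trans ((measure_union_le _ _).trans ?_)
  rw [Real.volume_Icc, Real.volume_Icc, ← ENNReal.ofReal_add (by linarith) (by linarith)]
  exact ENNReal.ofReal_le_ofReal (by linarith)

lemma volume_forall_gridDist_sub_le {n : ℕ} (c : Fin n → ℝ) (I : Finset (Fin n)) {σ : ℝ}
    (hσ : 0 ≤ σ) :
    volume {v : Fin n → ℝ | v ∈ Icc (0 : Fin n → ℝ) 1 ∧ ∀ i ∈ I, gridDist (c i - v i) ≤ σ} ≤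
      ENNReal.ofReal (2 * σ) ^ I.card := by
  classical
  have hsub : {v : Fin n → ℝ | v ∈ Icc (0 : Fin n → ℝ) 1 ∧ ∀ i ∈ I, gridDist (c i - v i) ≤ σ} ⊆
      Set.pi univ fun i => {t : ℝ | t ∈ Icc (0 : ℝ) 1 ∧ (i ∈ I → gridDist (c i - t) ≤ σ)} := by
    rintro v ⟨hv, h⟩ i -
    exact ⟨⟨hv.1 i, hv.2 i⟩, h i⟩
  refine (measure_mono hsub).trans ?_
  rw [volume_pi_pi]
  calc _ ≤ ∏ i : Fin n, (if i ∈ I then ENNReal.ofReal (2 * σ) else 1) := by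
        refine Finset.prod_le_prod' fun i _ => ?_
        split_ifs with hi
        · simpa [hi] using volume_gridDist_sub_le (c i) hσ
        · simp only [hi, false_implies, and_true]
          change volume (Icc (0 : ℝ) 1) ≤ 1
          simp
    _ = _ := by
        rw [Finset.prod_ite_mem, Finset.univ_inter, Finset.prod_const]

/-- Codimension count: the dual skeleton has codimension `k + 1`, so that the translated grids
whose dual skeleton is `σ`-close to a given point have measure `O(σ ^ (k + 1))`. -/
lemma volume_dualDist_sub_le {n : ℕ} (k : ℕ) (c : Fin n → ℝ) {σ : ℝ} (hσ : 0 ≤ σ)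
    (hσ1 : σ < 1) :
    volume {v : Fin n → ℝ | v ∈ Icc (0 : Fin n → ℝ) 1 ∧ dualDist k (fun i => c i - v i) ≤ σ} ≤
      2 ^ n * ENNReal.ofReal (2 * σ) ^ (k + 1) := by
  have hsub : {v : Fin n → ℝ | v ∈ Icc (0 : Fin n → ℝ) 1 ∧ dualDist k (fun i => c i - v i) ≤ σ} ⊆
      ⋃ I ∈ Finset.powersetCard (k + 1) (Finset.univ : Finset (Fin n)),
        {v | v ∈ Icc (0 : Fin n → ℝ) 1 ∧ ∀ i ∈ I, gridDist (c i - v i) ≤ σ} := by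
    rintro v ⟨hv, h⟩
    rw [dualDist_le_iff hσ] at h
    obtain h | ⟨I, hI, h⟩ := h
    · linarith
    · simp only [mem_iUnion, Finset.mem_powersetCard]
      exact ⟨I, ⟨Finset.subset_univ _, hI⟩, hv, h⟩
  refine (measure_mono hsub).trans ((measure_biUnion_finset_le _ _).trans ?_)
  calc _ ≤ ∑ _I ∈ Finset.powersetCard (k + 1) (Finset.univ : Finset (Fin n)),
        ENNReal.ofReal (2 * σ) ^ (k + 1) := by
        refine Finset.sum_le_sum fun I hI => ?_
        rw [← (Finset.mem_powersetCard.1 hI).2]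
        exact volume_forall_gridDist_sub_le c I hσ
    _ ≤ _ := by
        rw [Finset.sum_const, nsmul_eq_mul]
        gcongr
        rw [Finset.card_powersetCard, Finset.card_univ, Fintype.card_fin]
        exact_mod_cast Nat.choose_le_two_pow n (k + 1)

/-- The nearest point to `s` in `[0, 1]`. -/
noncomputable def unitClamp (s : ℝ) : ℝ := max 0 (min 1 s)

lemma unitClamp_nonneg (s : ℝ) : 0 ≤ unitClamp s := le_max_left _ _

lemma unitClamp_le_one (s : ℝ) : unitClamp s ≤ 1 := max_le zero_le_one (min_le_left _ _)

lemma unitClamp_of_one_le {s : ℝ} (h : 1 ≤ s) : unitClamp s = 1 := by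
  simp [unitClamp, h]

lemma unitClamp_of_nonpos {s : ℝ} (h : s ≤ 0) : unitClamp s = 0 := by
  simp [unitClamp, h]

lemma abs_unitClamp_sub_le (s t : ℝ) : |unitClamp s - unitClamp t| ≤ |s - t| :=
  abs_clamp_sub_le _ _ _ _

lemma continuous_unitClamp : Continuous unitClamp := by unfold unitClamp; fun_prop

/-- The uniform probability on the parameters `(v, a)`: `v` translates the grid, `a` shifts
the radius of the cutoff. -/
noncomputable def gridParam (n : ℕ) : Measure ((Fin n → ℝ) × ℝ) :=
  (volume.restrict (Icc (0 : Fin n → ℝ) 1)).prod (volume.restrict (Icc (0 : ℝ) 1))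

lemma volume_Icc_zero_one_pi (n : ℕ) : volume (Icc (0 : Fin n → ℝ) 1) = 1 := by
  simp [Real.volume_Icc_pi]

instance (n : ℕ) : IsProbabilityMeasure (volume.restrict (Icc (0 : Fin n → ℝ) 1)) :=
  ⟨by simp [volume_Icc_zero_one_pi]⟩

instance : IsProbabilityMeasure (volume.restrict (Icc (0 : ℝ) 1)) := ⟨by simp⟩

instance (n : ℕ) : IsProbabilityMeasure (gridParam n) := by unfold gridParam; infer_instance

/-- The random shift of the cutoff gains one more power of `σ`. It makes the average of
`(max (dualDist k) (unitClamp (t - a))) ^ (-d)` finite even for `k + 1 = d`, where the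
average over `v` alone diverges logarithmically. -/
lemma gridParam_le {n k d : ℕ} (hk : d ≤ k + 1) (c : Fin n → ℝ) (t : ℝ) {σ : ℝ} (hσ : 0 < σ)
    (hσ1 : σ ≤ 1) :
    gridParam n {p | max (dualDist k fun i => c i - p.1 i) (unitClamp (t - p.2)) ≤ σ ∧
      0 < unitClamp (t - p.2)} ≤ 2 ^ (n + k + 1) * ENNReal.ofReal σ ^ (d + 1) := by
  rcases hσ1.eq_or_lt with rfl | hσ1
  · refine prob_le_one.trans ?_
    rw [ENNReal.ofReal_one, one_pow, mul_one]
    exact one_le_pow₀ (by norm_num)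
  have hsub : {p : (Fin n → ℝ) × ℝ | max (dualDist k fun i => c i - p.1 i)
      (unitClamp (t - p.2)) ≤ σ ∧ 0 < unitClamp (t - p.2)} ⊆
      {v | dualDist k (fun i => c i - v i) ≤ σ} ×ˢ Icc (t - σ) t := by
    rintro ⟨v, a⟩ ⟨h, h0⟩
    rw [max_le_iff] at h
    refine ⟨h.1, ?_⟩
    have h2 := h.2
    constructor
    · by_contra! hlt
      have : unitClamp (t - a) ≤ σ := h.2
      unfold unitClamp at this
      have h3 : min 1 (t - a) ≤ σ := (le_max_right _ _).trans this
      rcases min_le_iff.1 h3 with h4 | h4 <;> simp only at hlt <;> linarith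
    · by_contra! hlt
      simp only at hlt h0
      rw [unitClamp_of_nonpos (by linarith)] at h0
      exact lt_irrefl _ h0
  refine (measure_mono hsub).trans ?_
  have hmeas : MeasurableSet {v : Fin n → ℝ | dualDist k (fun i => c i - v i) ≤ σ} :=
    (isClosed_le (continuous_dualDist.comp (by fun_prop)) continuous_const).measurableSet
  rw [gridParam, Measure.prod_prod, Measure.restrict_apply hmeas]
  have h1 : volume ({v : Fin n → ℝ | dualDist k (fun i => c i - v i) ≤ σ} ∩ Icc 0 1) ≤
      2 ^ n * ENNReal.ofReal (2 * σ) ^ (k + 1) := by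
    refine le_trans (measure_mono ?_) (volume_dualDist_sub_le k c hσ.le hσ1)
    rintro v ⟨h, hv⟩; exact ⟨hv, h⟩
  have h2 : volume.restrict (Icc (0 : ℝ) 1) (Icc (t - σ) t) ≤ ENNReal.ofReal σ := by
    refine (Measure.restrict_apply_le _ _).trans ?_
    rw [Real.volume_Icc]; exact ENNReal.ofReal_le_ofReal (by linarith)
  refine (mul_le_mul' h1 h2).trans ?_
  rw [ENNReal.ofReal_mul (by norm_num), mul_pow, ENNReal.ofReal_ofNat]
  have h3 : ENNReal.ofReal σ ^ (k + 1) ≤ ENNReal.ofReal σ ^ d :=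
    pow_le_pow_right_of_le_one' (by simpa using hσ1.le) hk
  calc 2 ^ n * (2 ^ (k + 1) * ENNReal.ofReal σ ^ (k + 1)) * ENNReal.ofReal σ
      = 2 ^ (n + k + 1) * (ENNReal.ofReal σ ^ (k + 1) * ENNReal.ofReal σ) := by ring
    _ ≤ 2 ^ (n + k + 1) * (ENNReal.ofReal σ ^ d * ENNReal.ofReal σ) := by gcongr
    _ = _ := by ring

/-- First moment method: if each point lies in the random set `B j` with probability at most
`C 2 ^ (-j (d + 1))`, then some parameter outside a set of probability at most `1 / 2` has
`∑ 2 ^ (j d) μ (B j) ≤ 4 C μ univ`. -/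
lemma exists_tsum_measure_le {Ω X : Type*} [MeasurableSpace Ω] [MeasurableSpace X]
    (P : Measure Ω) [IsProbabilityMeasure P] (μ : Measure X) [IsFiniteMeasure μ] {V : Set Ω}
    (hV : P V ≤ 1 / 2) (B : ℕ → Set (Ω × X)) (hB : ∀ j, MeasurableSet (B j)) (d : ℕ) (C : ℝ≥0∞)
    (hC : ∀ j y, P {ω | (ω, y) ∈ B j} ≤ C * (2⁻¹ ^ j) ^ (d + 1)) :
    ∃ ω ∉ V, ∑' j, ((2 : ℝ≥0∞) ^ j) ^ d * μ {y | (ω, y) ∈ B j} ≤ 4 * C * μ univ := by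
  set Ψ : Ω → ℝ≥0∞ := fun ω => ∑' j, ((2 : ℝ≥0∞) ^ j) ^ d * μ {y | (ω, y) ∈ B j} with hΨ
  have hm : ∀ j, Measurable fun ω => μ {y | (ω, y) ∈ B j} := fun j =>
    measurable_measure_prodMk_left (hB j)
  have hΨm : Measurable Ψ := Measurable.tsum fun j => (hm j).const_mul _
  have hint : ∫⁻ ω, Ψ ω ∂P ≤ 2 * C * μ univ := by
    rw [hΨ, lintegral_tsum fun j => ((hm j).const_mul _).aemeasurable]
    calc _ ≤ ∑' j : ℕ, C * μ univ * 2⁻¹ ^ j := by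
          refine ENNReal.tsum_le_tsum fun j => ?_
          rw [lintegral_const_mul _ (hm j)]
          have e1 : ∫⁻ ω, μ {y | (ω, y) ∈ B j} ∂P = ∫⁻ y, P {ω | (ω, y) ∈ B j} ∂μ := by
            have h1 := Measure.prod_apply (μ := P) (ν := μ) (hB j)
            have h2 := Measure.prod_apply_symm (μ := P) (ν := μ) (hB j)
            exact h1.symm.trans h2
          rw [e1]
          have e2 : ∫⁻ y, P {ω | (ω, y) ∈ B j} ∂μ ≤ C * (2⁻¹ ^ j) ^ (d + 1) * μ univ := by
            refine (lintegral_mono fun y => hC j y).trans ?_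
            rw [lintegral_const]
          refine (mul_le_mul_right e2 _).trans (le_of_eq ?_)
          have e3 : ((2 : ℝ≥0∞) ^ j) ^ d * (2⁻¹ ^ j) ^ d = 1 := by
            rw [← mul_pow, ← mul_pow, ENNReal.mul_inv_cancel (by norm_num) (by norm_num)]; simp
          calc _ = C * μ univ * 2⁻¹ ^ j * (((2 : ℝ≥0∞) ^ j) ^ d * (2⁻¹ ^ j) ^ d) := by ring
            _ = _ := by rw [e3, mul_one]
      _ = 2 * C * μ univ := by
          rw [ENNReal.tsum_mul_left, ENNReal.tsum_geometric, ENNReal.one_sub_inv_two, inv_inv]; ring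
  set G : Set Ω := (toMeasurable P V)ᶜ with hG
  have hPV : P (toMeasurable P V) ≤ 1 / 2 := by rwa [measure_toMeasurable]
  have hPG : 1 / 2 ≤ P G := by
    rw [hG, prob_compl_eq_one_sub (measurableSet_toMeasurable _ _)]
    calc (1 / 2 : ℝ≥0∞) = 1 - 1 / 2 := by simp
      _ ≤ _ := tsub_le_tsub_left hPV _
  have hG0 : P G ≠ 0 := fun h => by rw [h] at hPG; simp at hPG
  obtain ⟨ω, hω, hle⟩ := exists_le_setLAverage (μ := P) (s := G) hG0 (measure_ne_top _ _)
    hΨm.aemeasurable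
  refine ⟨ω, fun h => hω (subset_toMeasurable P V h), hle.trans ?_⟩
  rw [setLAverage_eq]
  have h1 : ∫⁻ ω in G, Ψ ω ∂P ≤ 2 * C * μ univ := (setLIntegral_le_lintegral _ _).trans hint
  rw [ENNReal.div_eq_inv_mul]
  have h2 : (P G)⁻¹ ≤ 2 := by
    rw [ENNReal.inv_le_iff_inv_le]; simpa using hPG
  calc _ ≤ 2 * (2 * C * μ univ) := mul_le_mul' h2 h1
    _ = _ := by ring

end averaging

/-- A map whose Lipschitz constant on `{σ ≤ m}` is `O(1 / σ)`: the measure of the image is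
estimated on the dyadic level sets of `m`. -/
lemma hausdorffMeasure_image_le_tsum {X Y : Type*} [MetricSpace X] [MeasurableSpace X]
    [BorelSpace X] [MetricSpace Y] [MeasurableSpace Y] [BorelSpace Y] (d : ℕ) {A : Set X}
    {m : X → ℝ} (hm0 : ∀ x ∈ A, 0 < m x) (hm1 : ∀ x ∈ A, m x ≤ 1) {f : X → Y} {L : ℝ}
    (hL : 0 ≤ L) (hf : ∀ σ > 0, ∀ x ∈ A, ∀ y ∈ A, σ ≤ m x → σ ≤ m y →
      dist (f x) (f y) ≤ L / σ * dist x y) :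
    μH[(d : ℝ)] (f '' A) ≤ ENNReal.ofReal (2 * L) ^ d *
      ∑' j : ℕ, ((2 : ℝ≥0∞) ^ j) ^ d * μH[(d : ℝ)] (A ∩ {x | m x ≤ 2⁻¹ ^ j}) := by
  have hcov : f '' A ⊆ ⋃ j : ℕ, f '' (A ∩ {x | m x ≤ 2⁻¹ ^ j ∧ 2⁻¹ ^ (j + 1) ≤ m x}) := by
    rintro _ ⟨x, hx, rfl⟩
    obtain ⟨j, hj, hj'⟩ := exists_nat_pow_near_of_lt_one (hm0 x hx) (hm1 x hx)
      (show (0 : ℝ) < 2⁻¹ by norm_num) (by norm_num)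
    exact mem_iUnion.2 ⟨j, x, ⟨hx, hj', hj.le⟩, rfl⟩
  refine (measure_mono hcov).trans ((measure_iUnion_le _).trans ?_)
  rw [← ENNReal.tsum_mul_left]
  refine ENNReal.tsum_le_tsum fun j => ?_
  have hlip : LipschitzOnWith (Real.toNNReal (2 * L * 2 ^ j)) f
      (A ∩ {x | m x ≤ 2⁻¹ ^ j ∧ 2⁻¹ ^ (j + 1) ≤ m x}) := by
    refine LipschitzOnWith.of_dist_le_mul fun x hx y hy => ?_
    rw [Real.coe_toNNReal _ (by positivity)]
    refine (hf (2⁻¹ ^ (j + 1)) (by positivity) x hx.1 y hy.1 hx.2.2 hy.2.2).trans (le_of_eq ?_)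
    rw [inv_pow, div_inv_eq_mul, pow_succ]; ring
  refine (hlip.hausdorffMeasure_image_le (Nat.cast_nonneg d)).trans ?_
  rw [ENNReal.rpow_natCast]
  change ENNReal.ofReal (2 * L * 2 ^ j) ^ d * _ ≤ _
  rw [ENNReal.ofReal_mul (by positivity), ENNReal.ofReal_pow (by norm_num), ENNReal.ofReal_ofNat,
    mul_pow, mul_assoc]
  gcongr
  exact fun h => h.1

/-! ### Skeleta and the translations to be avoided -/

section skeleta

variable {n : ℕ}

/-- The point with coordinates `g i` for `i ∈ J` and `c i` otherwise. -/
noncomputable def coordPlane (J : Finset (Fin n)) (c : Fin n → ℝ) (g : J → ℝ) :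
    EuclideanSpace ℝ (Fin n) :=
  WithLp.toLp 2 fun i => if h : i ∈ J then g ⟨i, h⟩ else c i

lemma lipschitzWith_coordPlane (J : Finset (Fin n)) (c : Fin n → ℝ) :
    LipschitzWith n (coordPlane J c) := by
  refine LipschitzWith.of_dist_le_mul fun g g' => ?_
  rw [dist_eq_norm, NNReal.coe_natCast]
  refine EuclideanSpace.norm_le_card_mul fun i => ?_
  simp only [coordPlane, PiLp.sub_apply]
  split_ifs with h
  · rw [← Real.dist_eq]; exact dist_le_pi_dist g g' _
  · simp

lemma coordPlane_restrict {J : Finset (Fin n)} {c : Fin n → ℝ} {y : EuclideanSpace ℝ (Fin n)}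
    (h : ∀ i ∉ J, y i = c i) : coordPlane J c (fun i => y i) = y := by
  ext i
  simp only [coordPlane]
  split_ifs with hi
  · rfl
  · exact (h i hi).symm

lemma hausdorffMeasure_image_coordPlane_eq_zero {d : ℕ} {J : Finset (Fin n)} (hJ : J.card < d)
    (c : Fin n → ℝ) (s : Set (J → ℝ)) : μH[(d : ℝ)] (coordPlane J c '' s) = 0 := by
  have h0 : μH[((d : ℝ≥0) : ℝ)] (univ : Set (J → ℝ)) = 0 := by
    refine hausdorffMeasure_of_dimH_lt ?_
    rw [Real.dimH_univ_pi, Fintype.card_coe]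
    exact_mod_cast hJ
  rw [NNReal.coe_natCast] at h0
  have := (lipschitzWith_coordPlane J c).hausdorffMeasure_image_le (Nat.cast_nonneg d) s
  rw [measure_mono_null (subset_univ s) h0, mul_zero] at this
  exact le_antisymm this zero_le

lemma hausdorffMeasure_gridSkeleton_eq_zero {d k : ℕ} (hk : k < d) (δ : ℝ) (v : Fin n → ℝ) :
    μH[(d : ℝ)] (gridSkeleton k δ v) = 0 := by
  have hsub : gridSkeleton k δ v ⊆ ⋃ p : {J : Finset (Fin n) // J.card ≤ k} × (Fin n → ℤ),
      coordPlane p.1.1 (fun i => δ * (p.2 i + 1 / 2 + v i)) '' univ := by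
    rintro y ⟨J, hJ, h⟩
    have : ∀ i, ∃ m : ℤ, i ∉ J → y i = δ * (m + 1 / 2 + v i) := fun i => by
      by_cases hi : i ∈ J
      · exact ⟨0, fun h => absurd hi h⟩
      · obtain ⟨m, hm⟩ := h i hi
        exact ⟨m, fun _ => hm⟩
    choose m hm using this
    exact mem_iUnion.2 ⟨⟨⟨J, hJ⟩, m⟩, _, mem_univ _, coordPlane_restrict hm⟩
  refine measure_mono_null hsub (measure_iUnion_null fun p => ?_)
  exact hausdorffMeasure_image_coordPlane_eq_zero (p.1.2.trans_lt hk) _ _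

/-- The integers of a real interval, together with `0`. -/
noncomputable def intsBetween (a b : ℝ) : Finset ℤ := insert 0 (Finset.Icc ⌈a⌉ ⌊b⌋)

lemma card_intsBetween_le {a b : ℝ} (h : a ≤ b) : ((intsBetween a b).card : ℝ) ≤ b - a + 2 := by
  have h1 : ((intsBetween a b).card : ℝ) ≤ ((Finset.Icc ⌈a⌉ ⌊b⌋).card : ℝ) + 1 := by
    exact_mod_cast Finset.card_insert_le _ _
  rw [Int.card_Icc] at h1
  have h2 : (((⌊b⌋ + 1 - ⌈a⌉).toNat : ℤ) : ℝ) ≤ b - a + 1 := by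
    rw [Int.toNat_eq_max]
    push_cast
    refine max_le ?_ (by linarith)
    linarith [Int.floor_le b, Int.le_ceil a]
  rw [Int.cast_natCast] at h2
  linarith

lemma card_piFinset_intsBetween_le {a b : Fin n → ℝ} {c : ℝ} (h : ∀ i, a i ≤ b i)
    (hc : ∀ i, b i - a i + 2 ≤ c) :
    ((Fintype.piFinset fun i => intsBetween (a i) (b i)).card : ℝ≥0∞) ≤ ENNReal.ofReal c ^ n := by
  rw [Fintype.card_piFinset, Nat.cast_prod]
  calc _ ≤ ∏ _i : Fin n, ENNReal.ofReal c := by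
        refine Finset.prod_le_prod' fun i _ => ?_
        rw [← ENNReal.ofReal_natCast]
        exact ENNReal.ofReal_le_ofReal ((card_intsBetween_le (h i)).trans (hc i))
    _ = _ := by simp

/-- The `d`-skeleton of the grid of mesh `δ` has measure `O((R / δ) ^ n R ^ d)` in a ball of
radius `R`: each `d`-plane carrying faces contributes at most `O(R ^ d)`. -/
lemma hausdorffMeasure_gridSkeleton_inter_closedBall_le (d : ℕ) {δ R : ℝ} (hδ : 0 < δ) (hR : 0 ≤ R)
    (v : Fin n → ℝ) (z : EuclideanSpace ℝ (Fin n)) :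
    μH[(d : ℝ)] (gridSkeleton d δ v ∩ Metric.closedBall z R) ≤
      2 ^ n * ENNReal.ofReal (2 * R / δ + 2) ^ n * (n ^ d * ENNReal.ofReal (2 * R) ^ d) := by
  classical
  set lo : Fin n → ℝ := fun i => (z i - R) / δ - 1 / 2 - v i
  set hi : Fin n → ℝ := fun i => (z i + R) / δ - 1 / 2 - v i
  have hlh : ∀ i, hi i - lo i = 2 * R / δ := fun i => by simp only [hi, lo]; ring
  set T : Finset (Finset (Fin n) × (Fin n → ℤ)) :=
    (Finset.univ.filter fun J : Finset (Fin n) => J.card ≤ d) ×ˢ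
      Fintype.piFinset fun i => intsBetween (lo i) (hi i)
  have hsub : gridSkeleton d δ v ∩ Metric.closedBall z R ⊆ ⋃ p ∈ T,
      coordPlane p.1 (fun i => δ * (p.2 i + 1 / 2 + v i)) ''
        Icc (fun i => z i - R) (fun i => z i + R) := by
    rintro y ⟨⟨J, hJ, h⟩, hy⟩
    have hyz : ∀ i, |y i - z i| ≤ R := fun i =>
      (EuclideanSpace.abs_apply_sub_le y z i).trans (Metric.mem_closedBall.1 hy)
    have : ∀ i, ∃ m : ℤ, m ∈ intsBetween (lo i) (hi i) ∧
        (i ∉ J → y i = δ * (m + 1 / 2 + v i)) := fun i => by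
      by_cases hi' : i ∈ J
      · exact ⟨0, by simp [intsBetween], fun h => absurd hi' h⟩
      · obtain ⟨m, hm⟩ := h i hi'
        refine ⟨m, ?_, fun _ => hm⟩
        have e : (m : ℝ) = y i / δ - 1 / 2 - v i := by rw [hm]; field_simp; ring
        have h1 := abs_le.1 (hyz i)
        refine Finset.mem_insert_of_mem (Finset.mem_Icc.2 ⟨Int.ceil_le.2 ?_, Int.le_floor.2 ?_⟩)
        · rw [e]; simp only [lo]; gcongr; linarith
        · rw [e]; simp only [hi]; gcongr; linarith
    choose m hm using this
    refine mem_biUnion (x := (J, m)) ?_ ⟨fun i => y i, ?_, coordPlane_restrict fun i => (hm i).2⟩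
    · simp only [T, Finset.coe_product, mem_prod, Finset.mem_coe, Finset.mem_filter,
        Finset.mem_univ, true_and, Fintype.mem_piFinset]
      exact ⟨hJ, fun i => (hm i).1⟩
    · constructor <;> intro i <;> have h1 := abs_le.1 (hyz i) <;> simp only <;> linarith
  refine (measure_mono hsub).trans ((measure_biUnion_finset_le _ _).trans ?_)
  have hcell : ∀ p ∈ T, μH[(d : ℝ)] (coordPlane p.1 (fun i => δ * (p.2 i + 1 / 2 + v i)) ''
      Icc (fun i => z i - R) (fun i => z i + R)) ≤ n ^ d * ENNReal.ofReal (2 * R) ^ d := by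
    intro p hp
    have hJ : p.1.card ≤ d := by
      have := (Finset.mem_product.1 hp).1
      simpa using this
    rcases hJ.lt_or_eq with hJ | hJ
    · rw [hausdorffMeasure_image_coordPlane_eq_zero hJ]; exact zero_le
    · refine ((lipschitzWith_coordPlane _ _).hausdorffMeasure_image_le (Nat.cast_nonneg d) _).trans ?_
      rw [ENNReal.rpow_natCast]
      have hvol : (μH[(d : ℝ)] : Measure (p.1 → ℝ)) = volume := by
        rw [← hausdorffMeasure_pi_real, Fintype.card_coe, hJ]
      rw [hvol, Real.volume_Icc_pi]
      have : ∀ i : p.1, (z i + R) - (z i - R) = 2 * R := fun i => by ring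
      simp [this, hJ]
  refine (Finset.sum_le_sum hcell).trans ?_
  rw [Finset.sum_const, nsmul_eq_mul]
  gcongr
  rw [Finset.card_product, Nat.cast_mul]
  gcongr
  · refine le_trans (b := ((Finset.univ : Finset (Finset (Fin n))).card : ℝ≥0∞)) ?_ ?_
    · exact_mod_cast Finset.card_filter_le _ _
    · simp
  · refine card_piFinset_intsBetween_le (fun i => ?_) (fun i => by rw [hlh])
    have := hlh i
    have : 0 ≤ 2 * R / δ := by positivity
    linarith

lemma volume_Icc_inter_restrict_preimage_le (I : Finset (Fin n)) (X : Set (I → ℝ)) :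
    volume {v : Fin n → ℝ | v ∈ Icc (0 : Fin n → ℝ) 1 ∧ (fun i : I => v i) ∈ X} ≤ volume X := by
  have hmp := volume_preserving_piEquivPiSubtypeProd (fun _ : Fin n => ℝ) (fun i => i ∈ I)
  set e := MeasurableEquiv.piEquivPiSubtypeProd (fun _ : Fin n => ℝ) (fun i => i ∈ I)
  have hsub : {v : Fin n → ℝ | v ∈ Icc (0 : Fin n → ℝ) 1 ∧ (fun i : I => v i) ∈ X} ⊆
      e ⁻¹' (X ×ˢ Icc 0 1) := by
    rintro v ⟨hv, hX⟩
    exact ⟨hX, fun i => hv.1 i, fun i => hv.2 i⟩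
  refine (measure_mono hsub).trans ?_
  rw [hmp.measure_preimage_equiv]
  refine (Measure.prod_prod X (Icc 0 1)).trans_le ?_
  rw [Real.volume_Icc_pi]
  simp only [Pi.one_apply, Pi.zero_apply, sub_zero, ENNReal.ofReal_one, Finset.prod_const_one,
    mul_one]
  convert! le_refl (volume X)

/-- The translations of the grid for which the dual skeleton meets `K` have measure
`O(μH[k + 1] K)`, since the projection of `K` to any `k + 1` coordinates is small. -/
lemma volume_dualDist_eq_zero_le (k : ℕ) {δ R : ℝ} (hδ : 0 < δ) (hR : 0 ≤ R)
    {K : Set (EuclideanSpace ℝ (Fin n))} {z : EuclideanSpace ℝ (Fin n)}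
    (hK : K ⊆ Metric.closedBall z R) :
    volume {v : Fin n → ℝ | v ∈ Icc (0 : Fin n → ℝ) 1 ∧
        ∃ y ∈ K, dualDist k (gridCoord δ v y) = 0} ≤
      2 ^ n * ENNReal.ofReal (2 * R / δ + 3) ^ n *
        (ENNReal.ofReal δ⁻¹ ^ (k + 1) * μH[((k + 1 : ℕ) : ℝ)] K) := by
  classical
  set lo : Fin n → ℝ := fun i => (z i - R) / δ - 1
  set hi : Fin n → ℝ := fun i => (z i + R) / δ
  have hlh : ∀ i, hi i - lo i + 2 = 2 * R / δ + 3 := fun i => by simp only [hi, lo]; ring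
  set T : Finset (Finset (Fin n) × (Fin n → ℤ)) :=
    Finset.powersetCard (k + 1) Finset.univ ×ˢ
      Fintype.piFinset fun i => intsBetween (lo i) (hi i)
  have hsub : {v : Fin n → ℝ | v ∈ Icc (0 : Fin n → ℝ) 1 ∧
        ∃ y ∈ K, dualDist k (gridCoord δ v y) = 0} ⊆ ⋃ p ∈ T,
      {v : Fin n → ℝ | v ∈ Icc (0 : Fin n → ℝ) 1 ∧
        (fun i : p.1 => v i) ∈ (fun y (i : p.1) => y i / δ - p.2 i) '' K} := by
    rintro v ⟨hv, y, hy, h0⟩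
    obtain h0 | ⟨I, hI, h0⟩ := (dualDist_le_iff le_rfl).1 h0.le
    · norm_num at h0
    have hyz : ∀ i, |y i - z i| ≤ R := fun i =>
      (EuclideanSpace.abs_apply_sub_le y z i).trans (Metric.mem_closedBall.1 (hK hy))
    have hround : ∀ i ∈ I, y i / δ - v i = round (y i / δ - v i) := fun i hi' => by
      have := h0 i hi'
      unfold gridDist gridCoord at this
      have h2 : |y i / δ - v i - round (y i / δ - v i)| = 0 :=
        le_antisymm (by linarith) (abs_nonneg _)
      exact sub_eq_zero.1 (abs_eq_zero.1 h2)
    have : ∀ i, ∃ m : ℤ, m ∈ intsBetween (lo i) (hi i) ∧ (i ∈ I → v i = y i / δ - m) := fun i => by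
      by_cases hi' : i ∈ I
      · refine ⟨round (y i / δ - v i), ?_, fun _ => by rw [← hround i hi']; ring⟩
        have h1 := abs_le.1 (hyz i)
        have h2 : (0 : ℝ) ≤ v i := hv.1 i
        have h3 : v i ≤ (1 : ℝ) := hv.2 i
        have h4 : (z i - R) / δ ≤ y i / δ := by gcongr; linarith
        have h5 : y i / δ ≤ (z i + R) / δ := by gcongr; linarith
        refine Finset.mem_insert_of_mem (Finset.mem_Icc.2 ⟨Int.ceil_le.2 ?_, Int.le_floor.2 ?_⟩)
        · rw [← hround i hi']; simp only [lo]; linarith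
        · rw [← hround i hi']; simp only [hi]; linarith
      · exact ⟨0, by simp [intsBetween], fun h => absurd h hi'⟩
    choose m hm using this
    refine mem_biUnion (x := (I, m)) ?_ ⟨hv, y, hy, ?_⟩
    · simp only [T, Finset.coe_product, mem_prod, Finset.mem_coe, Finset.mem_powersetCard,
        Fintype.mem_piFinset]
      exact ⟨⟨Finset.subset_univ _, hI⟩, fun i => (hm i).1⟩
    · ext i
      exact ((hm i).2 i.2).symm
  refine (measure_mono hsub).trans ((measure_biUnion_finset_le _ _).trans ?_)
  have hcell : ∀ p ∈ T, volume {v : Fin n → ℝ | v ∈ Icc (0 : Fin n → ℝ) 1 ∧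
        (fun i : p.1 => v i) ∈ (fun y (i : p.1) => y i / δ - p.2 i) '' K} ≤
      ENNReal.ofReal δ⁻¹ ^ (k + 1) * μH[((k + 1 : ℕ) : ℝ)] K := by
    intro p hp
    have hI : p.1.card = k + 1 := by
      have := (Finset.mem_product.1 hp).1
      exact (Finset.mem_powersetCard.1 this).2
    refine (volume_Icc_inter_restrict_preimage_le _ _).trans ?_
    rw [← hausdorffMeasure_pi_real, Fintype.card_coe, hI]
    have hlip : LipschitzOnWith (Real.toNNReal δ⁻¹)
        (fun (y : EuclideanSpace ℝ (Fin n)) (i : p.1) => y i / δ - p.2 i) K := by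
      refine LipschitzOnWith.of_dist_le_mul fun y _ y' _ => ?_
      rw [Real.coe_toNNReal _ (by positivity)]
      refine (dist_pi_le_iff (by positivity)).2 fun i => ?_
      rw [Real.dist_eq, sub_sub_sub_cancel_right, ← sub_div, abs_div, abs_of_pos hδ,
        inv_mul_eq_div]
      exact div_le_div_of_nonneg_right (EuclideanSpace.abs_apply_sub_le y y' i) hδ.le
    have := hlip.hausdorffMeasure_image_le (Nat.cast_nonneg (k + 1))
    rwa [ENNReal.rpow_natCast] at this
  refine (Finset.sum_le_sum hcell).trans ?_
  rw [Finset.sum_const, nsmul_eq_mul]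
  gcongr
  rw [Finset.card_product, Nat.cast_mul]
  gcongr
  · rw [Finset.card_powersetCard, Finset.card_univ, Fintype.card_fin]
    exact_mod_cast Nat.choose_le_two_pow n (k + 1)
  · refine card_piFinset_intsBetween_le (fun i => ?_) (fun i => by rw [hlh])
    have := hlh i
    have : 0 ≤ 2 * R / δ := by positivity
    linarith

end skeleta

/-! ### Deformation to a skeleton -/

/-- The consequence of almost minimality in a single ball that the argument uses:
Lipschitz maps of `E ∩ closedBall z R` into the ball, equal to the identity near the
boundary, decrease the Hausdorff measure by at most `η R ^ d`. -/
def AlmostMinIn {n : ℕ} (d : ℕ) (η : ℝ≥0∞) (E : Set (EuclideanSpace ℝ (Fin n)))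
    (z : EuclideanSpace ℝ (Fin n)) (R : ℝ) : Prop :=
  ∀ φ : EuclideanSpace ℝ (Fin n) → EuclideanSpace ℝ (Fin n),
    (∃ L : ℝ, ∀ y ∈ E ∩ Metric.closedBall z R, ∀ y' ∈ E ∩ Metric.closedBall z R,
      dist (φ y) (φ y') ≤ L * dist y y') →
    (∃ R' < R, ∀ y ∈ E ∩ Metric.closedBall z R, R' ≤ dist y z → φ y = y) →
    (∀ y ∈ E ∩ Metric.closedBall z R, φ y ∈ Metric.closedBall z R) →
    μH[(d : ℝ)] (E ∩ Metric.closedBall z R) ≤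
      μH[(d : ℝ)] (φ '' (E ∩ Metric.closedBall z R)) + η * ENNReal.ofReal R ^ d

section deformation

variable {n : ℕ}

/-- The retraction parameter of the deformation: `0` only on the dual skeleton inside the ball of
radius `ρ + a δ`, and `1` outside of the ball of radius `ρ + (1 + a) δ`. -/
noncomputable def gridCutoff (k : ℕ) (δ ρ : ℝ) (z : EuclideanSpace ℝ (Fin n))
    (p : (Fin n → ℝ) × ℝ) (y : EuclideanSpace ℝ (Fin n)) : ℝ :=
  max (dualDist k (gridCoord δ p.1 y)) (unitClamp ((dist y z - ρ) / δ - p.2))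

lemma abs_gridCutoff_sub_le (k : ℕ) {δ : ℝ} (hδ : 0 < δ) (ρ : ℝ) (z : EuclideanSpace ℝ (Fin n))
    (p : (Fin n → ℝ) × ℝ) (y y' : EuclideanSpace ℝ (Fin n)) :
    δ * |gridCutoff k δ ρ z p y - gridCutoff k δ ρ z p y'| ≤ 2 * dist y y' := by
  have h1 : |dualDist k (gridCoord δ p.1 y) - dualDist k (gridCoord δ p.1 y')| ≤
      2 * (dist y y' / δ) :=
    abs_dualDist_sub_le (abs_gridCoord_sub_le hδ p.1 y y') (by positivity)
  have h2 : |unitClamp ((dist y z - ρ) / δ - p.2) - unitClamp ((dist y' z - ρ) / δ - p.2)| ≤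
      2 * (dist y y' / δ) := by
    refine (abs_unitClamp_sub_le _ _).trans ?_
    rw [sub_sub_sub_cancel_right, ← sub_div, sub_sub_sub_cancel_right, abs_div, abs_of_pos hδ]
    have h3 : |dist y z - dist y' z| ≤ dist y y' := abs_dist_sub_le y y' z
    have h4 : |dist y z - dist y' z| / δ ≤ dist y y' / δ := by gcongr
    have : 0 ≤ dist y y' / δ := by positivity
    linarith
  have h3 := (abs_max_sub_max_le_max (dualDist k (gridCoord δ p.1 y))
    (unitClamp ((dist y z - ρ) / δ - p.2)) (dualDist k (gridCoord δ p.1 y'))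
    (unitClamp ((dist y' z - ρ) / δ - p.2))).trans (max_le h1 h2)
  calc _ ≤ δ * (2 * (dist y y' / δ)) := mul_le_mul_of_nonneg_left h3 hδ.le
    _ = _ := by field_simp

lemma dist_gridMap_gridCutoff_le (k : ℕ) {δ : ℝ} (hδ : 0 < δ) (ρ : ℝ)
    (z : EuclideanSpace ℝ (Fin n)) (p : (Fin n → ℝ) × ℝ) {σ : ℝ} (hσ : 0 < σ)
    {y y' : EuclideanSpace ℝ (Fin n)} (hy : σ ≤ gridCutoff k δ ρ z p y)
    (hy' : σ ≤ gridCutoff k δ ρ z p y') :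
    dist (gridMap δ p.1 (gridCutoff k δ ρ z p y) y)
      (gridMap δ p.1 (gridCutoff k δ ρ z p y') y') ≤ 3 * n / σ * dist y y' := by
  refine (dist_gridMap_le hδ p.1 hσ hy hy' (max_le dualDist_le_one (unitClamp_le_one _))
    y y').trans ?_
  have := abs_gridCutoff_sub_le k hδ ρ z p y y'
  calc _ ≤ n * ((dist y y' + 2 * dist y y') / σ) := by gcongr
    _ = _ := by ring

lemma continuous_gridCoord (δ : ℝ) :
    Continuous fun q : ((Fin n → ℝ) × ℝ) × EuclideanSpace ℝ (Fin n) =>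
      gridCoord δ q.1.1 q.2 := by
  unfold gridCoord; fun_prop

lemma continuous_unitClamp_sub (δ ρ : ℝ) (z : EuclideanSpace ℝ (Fin n)) :
    Continuous fun q : ((Fin n → ℝ) × ℝ) × EuclideanSpace ℝ (Fin n) =>
      unitClamp ((dist q.2 z - ρ) / δ - q.1.2) := continuous_unitClamp.comp (by fun_prop)

lemma continuous_gridCutoff (k : ℕ) (δ ρ : ℝ) (z : EuclideanSpace ℝ (Fin n)) :
    Continuous fun q : ((Fin n → ℝ) × ℝ) × EuclideanSpace ℝ (Fin n) =>
      gridCutoff k δ ρ z q.1 q.2 :=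
  (continuous_dualDist.comp (continuous_gridCoord δ)).max (continuous_unitClamp_sub δ ρ z)

lemma continuous_gridCutoff_right (k : ℕ) (δ ρ : ℝ) (z : EuclideanSpace ℝ (Fin n))
    (p : (Fin n → ℝ) × ℝ) : Continuous (gridCutoff k δ ρ z p) :=
  have h : Continuous fun y : EuclideanSpace ℝ (Fin n) => gridCoord δ p.1 y := by
    unfold gridCoord; fun_prop
  (continuous_dualDist.comp h).max (continuous_unitClamp.comp (by fun_prop))

/-- Choice of a good translation `p.1`, outside of the set `V` of bad ones, and of a good radius. -/
lemma exists_gridParam {d k : ℕ} (hk : d ≤ k + 1) (δ ρ : ℝ) (z : EuclideanSpace ℝ (Fin n))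
    (μ : Measure (EuclideanSpace ℝ (Fin n))) [IsFiniteMeasure μ] {V : Set (Fin n → ℝ)}
    (hV : volume (V ∩ Icc 0 1) ≤ 1 / 2) :
    ∃ p : (Fin n → ℝ) × ℝ, p.1 ∉ V ∧ p.2 ∈ Icc (0 : ℝ) 1 ∧
      ∑' j : ℕ, ((2 : ℝ≥0∞) ^ j) ^ d * μ {y | gridCutoff k δ ρ z p y ≤ 2⁻¹ ^ j ∧
        0 < unitClamp ((dist y z - ρ) / δ - p.2)} ≤ 4 * 2 ^ (n + k + 1) * μ univ := by
  have hbad : gridParam n (V ×ˢ univ ∪ univ ×ˢ (Icc (0 : ℝ) 1)ᶜ) ≤ 1 / 2 := by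
    refine (measure_union_le _ _).trans ?_
    have h0 : volume.restrict (Icc (0 : ℝ) 1) (Icc (0 : ℝ) 1)ᶜ = 0 := by
      rw [Measure.restrict_apply' measurableSet_Icc, compl_inter_self, measure_empty]
    rw [gridParam, Measure.prod_prod, Measure.prod_prod, h0, mul_zero, add_zero, measure_univ,
      mul_one, Measure.restrict_apply' measurableSet_Icc]
    exact hV
  obtain ⟨p, hp, hsum⟩ := exists_tsum_measure_le (gridParam n) μ hbad
    (fun j => {q : ((Fin n → ℝ) × ℝ) × EuclideanSpace ℝ (Fin n) |
      gridCutoff k δ ρ z q.1 q.2 ≤ 2⁻¹ ^ j ∧ 0 < unitClamp ((dist q.2 z - ρ) / δ - q.1.2)})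
    (fun j => ((isClosed_le (continuous_gridCutoff k δ ρ z) continuous_const).measurableSet).inter
      (isOpen_lt continuous_const (continuous_unitClamp_sub δ ρ z)).measurableSet) d
    (2 ^ (n + k + 1)) fun j y => by
      have := gridParam_le (n := n) hk (fun i => y i / δ) ((dist y z - ρ) / δ)
        (σ := 2⁻¹ ^ j) (by positivity) (pow_le_one₀ (by norm_num) (by norm_num))
      rw [ENNReal.ofReal_pow (by norm_num), ENNReal.ofReal_inv_of_pos (by norm_num),
        ENNReal.ofReal_ofNat] at this
      exact this
  simp only [mem_union, mem_prod, mem_univ, and_true, true_and, not_or, mem_compl_iff,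
    not_not] at hp
  exact ⟨p, hp.1, hp.2, hsum⟩

/-- **Deformation to the `k`-skeleton**, for `k ≥ d - 1`. If `E` is almost minimal in the ball of
radius `R ≥ ρ + (n + 3) δ`, and if at least half of the translates of the grid of mesh `δ` have a
dual skeleton that does not meet `E` in that ball, then the mass of `E` in the ball of radius `ρ` is controlled by
the mass of the `k`-skeleton and by the mass of `E` in the surrounding annulus. -/
lemma hausdorffMeasure_le_of_gridMap {d k : ℕ} (hk : d ≤ k + 1)
    {E : Set (EuclideanSpace ℝ (Fin n))} {z : EuclideanSpace ℝ (Fin n)} {ρ δ R : ℝ} {η : ℝ≥0∞}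
    (hδ : 0 < δ) (hR : ρ + (n + 3) * δ ≤ R)
    (hK : IsCompact (E ∩ Metric.closedBall z R))
    (hfin : μH[(d : ℝ)] (E ∩ Metric.closedBall z R) < ∞) (hmin : AlmostMinIn d η E z R)
    (hV : volume {v : Fin n → ℝ | v ∈ Icc (0 : Fin n → ℝ) 1 ∧
      ∃ y ∈ E ∩ Metric.closedBall z R, dualDist k (gridCoord δ v y) = 0} ≤ 1 / 2) :
    ∃ v : Fin n → ℝ, μH[(d : ℝ)] (E ∩ Metric.closedBall z ρ) ≤
      μH[(d : ℝ)] (gridSkeleton k δ v ∩ Metric.closedBall z R) +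
      ENNReal.ofReal (2 * (3 * n)) ^ d * (4 * 2 ^ (n + k + 1)) *
        μH[(d : ℝ)] ((E ∩ Metric.closedBall z R) \ Metric.closedBall z ρ) +
      η * ENNReal.ofReal R ^ d := by
  have hn : (0 : ℝ) ≤ n := Nat.cast_nonneg n
  set K := E ∩ Metric.closedBall z R with hKdef
  set A₀ := K \ Metric.closedBall z ρ with hA₀
  have hA₀fin : μH[(d : ℝ)] A₀ < ∞ := (measure_mono sdiff_subset).trans_lt hfin
  have : IsFiniteMeasure (μH[(d : ℝ)].restrict A₀) := ⟨by simpa using hA₀fin⟩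
  obtain ⟨⟨v, a⟩, hv, ⟨ha0, ha1⟩, hsum⟩ := exists_gridParam hk δ ρ z (μH[(d : ℝ)].restrict A₀)
    (V := {v | ∃ y ∈ K, dualDist k (gridCoord δ v y) = 0})
    ((measure_mono fun v hv => And.intro hv.2 hv.1).trans hV)
  simp only at ha0 ha1 hsum
  refine ⟨v, ?_⟩
  set m : EuclideanSpace ℝ (Fin n) → ℝ := gridCutoff k δ ρ z (v, a) with hm
  set lam : EuclideanSpace ℝ (Fin n) → ℝ := fun y => unitClamp ((dist y z - ρ) / δ - a) with hlam
  have hmc : Continuous m := continuous_gridCutoff_right k δ ρ z (v, a)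
  have hlc : Continuous lam := continuous_unitClamp.comp (by fun_prop)
  have hm_eq : ∀ y, m y = max (dualDist k (gridCoord δ v y)) (lam y) := fun y => rfl
  have hm1 : ∀ y, m y ≤ 1 := fun y => by
    rw [hm_eq]; exact max_le dualDist_le_one (unitClamp_le_one _)
  have hdual : ∀ y ∈ K, 0 < dualDist k (gridCoord δ v y) := fun y hy =>
    dualDist_nonneg.lt_of_ne' fun h => hv ⟨y, hy, h⟩
  have hm0 : ∀ y ∈ K, 0 < m y := fun y hy => by
    rw [hm_eq]; exact lt_max_of_lt_left (hdual y hy)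
  have hlam_one : ∀ y, ρ + 2 * δ ≤ dist y z → lam y = 1 := fun y hy => by
    refine unitClamp_of_one_le ?_
    have : 2 ≤ (dist y z - ρ) / δ := by rw [le_div_iff₀ hδ]; linarith
    linarith
  set φ : EuclideanSpace ℝ (Fin n) → EuclideanSpace ℝ (Fin n) := fun y => gridMap δ v (m y) y
    with hφ
  have hφ_self : ∀ y, lam y = 1 → φ y = y := fun y hy => by
    have : m y = 1 := le_antisymm (hm1 y) (hy ▸ le_max_right _ _)
    simp only [hφ, this, gridMap_one hδ]
  have hφ_maps : ∀ y ∈ K, φ y ∈ Metric.closedBall z R := fun y hy => by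
    rcases le_or_gt (ρ + 2 * δ) (dist y z) with h | h
    · rw [hφ_self y (hlam_one y h)]; exact hy.2
    · have h1 := dist_triangle (φ y) y z
      have h2 : dist (φ y) y ≤ n * δ := dist_gridMap_self_le hδ v (m y) y
      rw [Metric.mem_closedBall]
      nlinarith
  obtain ⟨σ₀, hσ₀, hσ₀m⟩ := hK.exists_forall_le' hmc.continuousOn hm0
  have hcomp := hmin φ ⟨3 * n / σ₀, fun y hy y' hy' =>
      dist_gridMap_gridCutoff_le k hδ ρ z (v, a) hσ₀ (hσ₀m y hy) (hσ₀m y' hy')⟩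
    ⟨ρ + 2 * δ, by nlinarith, fun y _ h => hφ_self y (hlam_one y h)⟩ hφ_maps
  set A := K ∩ {y | 0 < lam y ∧ lam y < 1} with hA
  have himage : φ '' K ⊆ (gridSkeleton k δ v ∩ Metric.closedBall z R) ∪ φ '' A ∪
      (K \ {y | lam y < 1}) := by
    rintro _ ⟨y, hy, rfl⟩
    rcases lt_or_ge (lam y) 1 with h1 | h1
    · left
      have hlam0 : 0 ≤ lam y := unitClamp_nonneg _
      rcases hlam0.eq_or_lt with h0 | h0
      · left
        refine ⟨?_, hφ_maps y hy⟩
        have : m y = dualDist k (gridCoord δ v y) := by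
          rw [hm_eq, ← h0, max_eq_left (hdual y hy).le]
        simp only [hφ, this]
        exact gridMap_mem_gridSkeleton (hdual y hy)
      · exact Or.inr ⟨y, ⟨hy, h0, h1⟩, rfl⟩
    · right
      rw [hφ_self y (le_antisymm (unitClamp_le_one _) h1)]
      exact ⟨hy, not_lt.2 h1⟩
  have hA₀m : MeasurableSet A₀ := hK.isClosed.measurableSet.diff Metric.isClosed_closedBall.measurableSet
  have hAsub : A ⊆ A₀ := by
    rintro y ⟨hy, h0, -⟩
    refine ⟨hy, fun hyρ => h0.ne' (unitClamp_of_nonpos ?_)⟩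
    have : (dist y z - ρ) / δ ≤ 0 :=
      div_nonpos_of_nonpos_of_nonneg (by linarith [Metric.mem_closedBall.1 hyρ]) hδ.le
    linarith
  have hφA : μH[(d : ℝ)] (φ '' A) ≤ ENNReal.ofReal (2 * (3 * n)) ^ d * (4 * 2 ^ (n + k + 1)) *
      μH[(d : ℝ)] A₀ := by
    refine (hausdorffMeasure_image_le_tsum d (m := m) (L := 3 * n) (fun y hy => hm0 y hy.1)
      (fun y _ => hm1 y) (by positivity) fun σ hσ y _ y' _ h h' =>
        dist_gridMap_gridCutoff_le k hδ ρ z (v, a) hσ h h').trans ?_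
    rw [mul_assoc]
    gcongr
    refine le_trans (ENNReal.tsum_le_tsum fun j => ?_)
      (hsum.trans_eq (by rw [Measure.restrict_apply_univ]))
    rw [Measure.restrict_apply' hA₀m]
    refine mul_le_mul_right (measure_mono ?_) _
    rintro y ⟨hy, hyj⟩
    exact ⟨⟨hyj, hy.2.1⟩, hAsub hy⟩
  have hsplit := measure_inter_add_sdiff (μ := μH[(d : ℝ)]) K
    (isOpen_lt hlc continuous_const : IsOpen {y | lam y < 1}).measurableSet
  have hdiff : μH[(d : ℝ)] (K \ {y | lam y < 1}) ≠ ∞ :=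
    ((measure_mono sdiff_subset).trans_lt hfin).ne
  have hρ : E ∩ Metric.closedBall z ρ ⊆ K ∩ {y | lam y < 1} := by
    rintro y ⟨hy, hyρ⟩
    refine ⟨⟨hy, Metric.closedBall_subset_closedBall (by nlinarith) hyρ⟩, ?_⟩
    have : (dist y z - ρ) / δ ≤ 0 :=
      div_nonpos_of_nonpos_of_nonneg (by linarith [Metric.mem_closedBall.1 hyρ]) hδ.le
    have h0 : lam y = 0 := unitClamp_of_nonpos (by linarith)
    simp [h0]
  refine (measure_mono hρ).trans ((ENNReal.add_le_add_iff_right hdiff).1 ?_)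
  rw [hsplit]
  refine hcomp.trans ?_
  have h1 : μH[(d : ℝ)] (φ '' K) ≤ μH[(d : ℝ)] (gridSkeleton k δ v ∩ Metric.closedBall z R) +
      μH[(d : ℝ)] (φ '' A) + μH[(d : ℝ)] (K \ {y | lam y < 1}) :=
    (measure_mono himage).trans ((measure_union_le _ _).trans
      (add_le_add_left (measure_union_le _ _) _))
  calc _ ≤ μH[(d : ℝ)] (gridSkeleton k δ v ∩ Metric.closedBall z R) +
      ENNReal.ofReal (2 * (3 * n)) ^ d * (4 * 2 ^ (n + k + 1)) * μH[(d : ℝ)] A₀ +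
      μH[(d : ℝ)] (K \ {y | lam y < 1}) + η * ENNReal.ofReal R ^ d := by
        refine add_le_add_left (h1.trans ?_) _
        gcongr
    _ = _ := by ring

end deformation

/-! ### Mass bounds at a given scale -/

/-- Iteration of a contraction with an error growing geometrically, but slower than `θ⁻¹`. -/
lemma le_div_of_le_mul_succ_add {f : ℕ → ℝ} {θ q D M : ℝ} (hθ : 0 ≤ θ) (hθ1 : θ < 1) (hq : 0 ≤ q)
    (hθq : θ * q < 1) (hD : 0 ≤ D) (hM : ∀ j, f j ≤ M)
    (h : ∀ j, f j ≤ θ * f (j + 1) + D * q ^ j) : f 0 ≤ D / (1 - θ * q) := by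
  have hM0 : ∀ J, f 0 ≤ θ ^ J * f J + D * ∑ j ∈ Finset.range J, (θ * q) ^ j := by
    intro J
    induction J with
    | zero => simp
    | succ J ih =>
      rw [Finset.sum_range_succ]
      have := mul_le_mul_of_nonneg_left (h J) (pow_nonneg hθ J)
      rw [mul_pow]
      calc f 0 ≤ _ := ih
        _ ≤ _ := by rw [pow_succ]; linarith
  have hsum : ∀ J, ∑ j ∈ Finset.range J, (θ * q) ^ j ≤ (1 - θ * q)⁻¹ := fun J => by
    rw [← tsum_geometric_of_lt_one (mul_nonneg hθ hq) hθq]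
    exact (summable_geometric_of_lt_one (mul_nonneg hθ hq) hθq).sum_le_tsum _
      fun j _ => pow_nonneg (mul_nonneg hθ hq) j
  have hlim : Tendsto (fun J : ℕ => θ ^ J * M + D / (1 - θ * q)) atTop
      (𝓝 (0 * M + D / (1 - θ * q))) :=
    ((tendsto_pow_atTop_nhds_zero_of_lt_one hθ hθ1).mul_const M).add_const _
  rw [zero_mul, zero_add] at hlim
  refine ge_of_tendsto' hlim fun J => (hM0 J).trans ?_
  rw [div_eq_mul_inv]
  exact add_le_add (mul_le_mul_of_nonneg_left (hM J) (pow_nonneg hθ J))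
    (mul_le_mul_of_nonneg_left (hsum J) hD)

/-- Iteration of `(1 + A) f i ≤ A f (i + 1) + e`. -/
lemma le_pow_mul_add_of_mul_le {f : ℕ → ℝ} {A e : ℝ} (hA : 0 ≤ A) {N : ℕ}
    (h : ∀ i < N, (1 + A) * f i ≤ A * f (i + 1) + e) :
    f 0 ≤ (A / (1 + A)) ^ N * f N + (1 - (A / (1 + A)) ^ N) * e := by
  induction N with
  | zero => simp
  | succ N ih =>
    have h1 := ih fun i hi => h i (hi.trans N.lt_succ_self)
    have hA1 : 0 < 1 + A := by linarith
    have h2 : f N ≤ A / (1 + A) * f (N + 1) + (1 - A / (1 + A)) * e := by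
      have := h N N.lt_succ_self
      have e1 : A / (1 + A) * f (N + 1) + (1 - A / (1 + A)) * e =
        (A * f (N + 1) + e) / (1 + A) := by field_simp; ring
      rw [e1, le_div_iff₀ hA1]; linarith
    have h3 := mul_le_mul_of_nonneg_left h2 (by positivity : 0 ≤ (A / (1 + A)) ^ N)
    rw [pow_succ]
    linarith

section bounds

variable {n : ℕ}

/-- The constant in front of the mass of the annulus in `hausdorffMeasure_le_of_gridMap`. -/
noncomputable def gridConst (n d k : ℕ) : ℝ := (2 * (3 * n)) ^ d * (4 * 2 ^ (n + k + 1))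

lemma gridConst_nonneg (n d k : ℕ) : 0 ≤ gridConst n d k := by unfold gridConst; positivity

lemma toReal_mul_le_of_gridMap {d k : ℕ} (hk : d ≤ k + 1)
    {E : Set (EuclideanSpace ℝ (Fin n))} {z : EuclideanSpace ℝ (Fin n)} {ρ δ R η S : ℝ}
    (hη : 0 ≤ η) (hS : 0 ≤ S) (hR0 : 0 ≤ R)
    (hδ : 0 < δ) (hR : ρ + (n + 3) * δ ≤ R)
    (hK : IsCompact (E ∩ Metric.closedBall z R))
    (hfin : μH[(d : ℝ)] (E ∩ Metric.closedBall z R) < ∞)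
    (hmin : AlmostMinIn d (ENNReal.ofReal η) E z R)
    (hV : volume {v : Fin n → ℝ | v ∈ Icc (0 : Fin n → ℝ) 1 ∧
      ∃ y ∈ E ∩ Metric.closedBall z R, dualDist k (gridCoord δ v y) = 0} ≤ 1 / 2)
    (hskel : ∀ v : Fin n → ℝ, μH[(d : ℝ)] (gridSkeleton k δ v ∩ Metric.closedBall z R) ≤
      ENNReal.ofReal S) :
    (1 + gridConst n d k) * (μH[(d : ℝ)] (E ∩ Metric.closedBall z ρ)).toReal ≤
      gridConst n d k * (μH[(d : ℝ)] (E ∩ Metric.closedBall z R)).toReal + (S + η * R ^ d) := by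
  obtain ⟨v, hv⟩ := hausdorffMeasure_le_of_gridMap hk hδ hR hK hfin hmin hV
  have hρR : ρ ≤ R := by nlinarith [(Nat.cast_nonneg n : (0 : ℝ) ≤ n)]
  have hsplit := measure_inter_add_sdiff (μ := μH[(d : ℝ)]) (E ∩ Metric.closedBall z R)
    (Metric.isClosed_closedBall (x := z) (ε := ρ)).measurableSet
  rw [inter_assoc, inter_eq_self_of_subset_right (Metric.closedBall_subset_closedBall hρR)]
    at hsplit
  have h1 : μH[(d : ℝ)] (E ∩ Metric.closedBall z ρ) ≠ ∞ :=
    (le_self_add.trans_lt (hsplit.trans_lt hfin)).ne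
  have h2 : μH[(d : ℝ)] ((E ∩ Metric.closedBall z R) \ Metric.closedBall z ρ) ≠ ∞ :=
    (le_add_self.trans_lt (hsplit.trans_lt hfin)).ne
  set x := μH[(d : ℝ)] (E ∩ Metric.closedBall z ρ)
  set y := μH[(d : ℝ)] ((E ∩ Metric.closedBall z R) \ Metric.closedBall z ρ)
  have hc : ENNReal.ofReal (2 * (3 * n)) ^ d * (4 * 2 ^ (n + k + 1)) =
      ENNReal.ofReal (gridConst n d k) := by
    unfold gridConst
    rw [ENNReal.ofReal_mul (p := (2 * (3 * (n : ℝ))) ^ d) (by positivity),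
      ENNReal.ofReal_pow (p := 2 * (3 * (n : ℝ))) (by positivity),
      ENNReal.ofReal_mul (p := 4) (by positivity), ENNReal.ofReal_pow (p := 2) (by positivity)]
    simp only [ENNReal.ofReal_ofNat]
  rw [hc] at hv
  have h3 : x ≤ ENNReal.ofReal (S + gridConst n d k * y.toReal + η * R ^ d) := by
    refine (hv.trans (add_le_add_left (add_le_add_left (hskel v) _) _)).trans_eq ?_
    have hg := gridConst_nonneg n d k
    rw [ENNReal.ofReal_add (by positivity) (by positivity),
      ENNReal.ofReal_add (by positivity) (by positivity), ENNReal.ofReal_mul hg,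
      ENNReal.ofReal_mul hη, ENNReal.ofReal_pow hR0, ENNReal.ofReal_toReal h2]
  have h4 := ENNReal.toReal_le_of_le_ofReal (by have := gridConst_nonneg n d k; positivity) h3
  rw [← hsplit, ENNReal.toReal_add h1 h2]
  linarith

/-- **Upper mass bound.** An almost minimal set has mass at most `C R ^ d` in the balls of
radius `R / 2`, whatever its mass in the ball of radius `R`. -/
lemma exists_hausdorffMeasure_le (n d : ℕ) : ∃ C : ℝ, 0 ≤ C ∧
    ∀ (E : Set (EuclideanSpace ℝ (Fin n))) (z : EuclideanSpace ℝ (Fin n)) (R : ℝ), 0 < R →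
      IsCompact (E ∩ Metric.closedBall z R) → μH[(d : ℝ)] (E ∩ Metric.closedBall z R) < ∞ →
      (∀ ρ, 0 < ρ → ρ ≤ R → AlmostMinIn d (ENNReal.ofReal 1) E z ρ) →
      (μH[(d : ℝ)] (E ∩ Metric.closedBall z (R / 2))).toReal ≤ C * R ^ d := by
  set A := gridConst n d d with hA
  have hA0 : 0 ≤ A := gridConst_nonneg n d d
  set θ := A / (1 + A) with hθ
  have hθ0 : 0 ≤ θ := by positivity
  have hθ1 : θ < 1 := by rw [hθ, div_lt_one (by linarith)]; linarith
  -- radii with gaps decaying like `a ^ j`, with `a` so close to `1` that `θ / a ^ n < 1`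
  obtain ⟨a, ha0, ha1, han⟩ : ∃ a : ℝ, 0 < a ∧ a < 1 ∧ θ < a ^ n := by
    have hc : Tendsto (fun a : ℝ => a ^ n) (𝓝[<] 1) (𝓝 1) := by
      have : Tendsto (fun a : ℝ => a ^ n) (𝓝 1) (𝓝 (1 ^ n)) := (continuous_pow n).tendsto 1
      rw [one_pow] at this
      exact this.mono_left nhdsWithin_le_nhds
    have h1 := hc.eventually (lt_mem_nhds hθ1)
    have h2 : ∀ᶠ a in 𝓝[<] (1 : ℝ), 0 < a :=
      (eventually_gt_nhds zero_lt_one).filter_mono nhdsWithin_le_nhds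
    obtain ⟨a, ⟨h, h'⟩, h''⟩ := ((h1.and h2).and self_mem_nhdsWithin).exists
    exact ⟨a, h', h'', h⟩
  set q := (a ^ n)⁻¹ with hq
  have hq0 : 0 ≤ q := by positivity
  have hθq : θ * q < 1 := by
    rw [hq, ← div_eq_mul_inv, div_lt_one (by positivity)]; exact han
  set Q : ℝ := 2 * (n + 3) / (1 - a) with hQ
  have h1a : 0 < 1 - a := by linarith
  have hQ1 : 1 ≤ Q := by
    rw [hQ, le_div_iff₀ h1a]
    have : (0 : ℝ) ≤ n := Nat.cast_nonneg n
    linarith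
  set B : ℝ := 2 ^ n * (4 * Q) ^ n * (n ^ d * 2 ^ d) + 1 with hB
  refine ⟨B / (1 - θ * q), div_nonneg (by positivity) (by linarith), ?_⟩
  intro E z R hR hK hfin hmin
  set ρ : ℕ → ℝ := fun j => R / 2 + R / 2 * (1 - a ^ j) with hρ
  have hapos : ∀ j : ℕ, 0 < a ^ j := fun j => by positivity
  have hale : ∀ j : ℕ, a ^ j ≤ 1 := fun j => pow_le_one₀ ha0.le ha1.le
  have hρR : ∀ j, ρ j ≤ R := fun j => by simp only [hρ]; nlinarith [hapos j]
  have hρ0 : ∀ j, 0 < ρ j := fun j => by simp only [hρ]; nlinarith [hale j]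
  have hKρ : ∀ j, IsCompact (E ∩ Metric.closedBall z (ρ j)) := fun j => by
    have := hK.inter_right (Metric.isClosed_closedBall (x := z) (ε := ρ j))
    rwa [inter_assoc, inter_eq_self_of_subset_right
      (Metric.closedBall_subset_closedBall (hρR j))] at this
  have hmono : ∀ j, μH[(d : ℝ)] (E ∩ Metric.closedBall z (ρ j)) ≤
      μH[(d : ℝ)] (E ∩ Metric.closedBall z R) := fun j =>
    measure_mono (inter_subset_inter_right _ (Metric.closedBall_subset_closedBall (hρR j)))
  have key := le_div_of_le_mul_succ_add (f := fun j => (μH[(d : ℝ)]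
    (E ∩ Metric.closedBall z (ρ j))).toReal) (D := B * R ^ d)
    (M := (μH[(d : ℝ)] (E ∩ Metric.closedBall z R)).toReal) hθ0 hθ1 hq0 hθq (by positivity)
    (fun j => ENNReal.toReal_mono hfin.ne (hmono j)) (fun j => ?_)
  · have h0 : ρ 0 = R / 2 := by simp [hρ]
    simp only [h0] at key
    calc _ ≤ _ := key
      _ = _ := by ring
  set δ : ℝ := R / Q * a ^ j with hδ
  have hδ0 : 0 < δ := by positivity
  have hδR : R / δ = Q * (a ^ j)⁻¹ := by rw [hδ]; field_simp
  have hstep : ρ j + (n + 3) * δ = ρ (j + 1) := by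
    simp only [hρ, hδ, hQ, pow_succ]; field_simp; ring
  have hqj : ((a ^ j)⁻¹) ^ n = q ^ j := by rw [hq, inv_pow, inv_pow, ← pow_mul, ← pow_mul, mul_comm]
  have hqj1 : 1 ≤ q ^ j := by
    rw [← hqj]
    exact one_le_pow₀ ((one_le_inv₀ (hapos j)).2 (hale j))
  have hskel : ∀ v : Fin n → ℝ,
      μH[(d : ℝ)] (gridSkeleton d δ v ∩ Metric.closedBall z (ρ (j + 1))) ≤
        ENNReal.ofReal (2 ^ n * (4 * Q) ^ n * (n ^ d * 2 ^ d) * q ^ j * R ^ d) := by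
    intro v
    refine (measure_mono (inter_subset_inter_right _
      (Metric.closedBall_subset_closedBall (hρR (j + 1))))).trans
      ((hausdorffMeasure_gridSkeleton_inter_closedBall_le d hδ0 hR.le v z).trans ?_)
    have h1 : 2 * R / δ + 2 ≤ 4 * Q * (a ^ j)⁻¹ := by
      have : 1 ≤ (a ^ j)⁻¹ := (one_le_inv₀ (hapos j)).2 (hale j)
      rw [mul_div_assoc, hδR]
      nlinarith
    calc _ ≤ 2 ^ n * ENNReal.ofReal (4 * Q * (a ^ j)⁻¹) ^ n *
          (n ^ d * ENNReal.ofReal (2 * R) ^ d) := by gcongr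
      _ = ENNReal.ofReal (2 ^ n * (4 * Q * (a ^ j)⁻¹) ^ n * (n ^ d * (2 * R) ^ d)) := by
          rw [ENNReal.ofReal_mul (p := 2 ^ n * (4 * Q * (a ^ j)⁻¹) ^ n) (by positivity),
            ENNReal.ofReal_mul (p := 2 ^ n) (by positivity),
            ENNReal.ofReal_mul (p := (n : ℝ) ^ d) (by positivity),
            ENNReal.ofReal_pow (p := 4 * Q * (a ^ j)⁻¹) (by positivity),
            ENNReal.ofReal_pow (p := 2 * R) (by positivity), ENNReal.ofReal_pow (p := 2) (by positivity),
            ENNReal.ofReal_pow (p := (n : ℝ)) (by positivity), ENNReal.ofReal_ofNat,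
            ENNReal.ofReal_natCast]
      _ = _ := by rw [mul_pow (4 * Q), hqj, mul_pow 2 R]; congr 1; ring
  have hV : volume {v : Fin n → ℝ | v ∈ Icc (0 : Fin n → ℝ) 1 ∧
      ∃ y ∈ E ∩ Metric.closedBall z (ρ (j + 1)), dualDist d (gridCoord δ v y) = 0} ≤ 1 / 2 := by
    have h0 : μH[((d + 1 : ℕ) : ℝ)] (E ∩ Metric.closedBall z (ρ (j + 1))) = 0 := by
      refine (Measure.hausdorffMeasure_zero_or_top (d₁ := (d : ℝ)) (by push_cast; linarith)
        _).resolve_right ?_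
      exact ((hmono _).trans_lt hfin).ne
    refine (volume_dualDist_eq_zero_le d hδ0 (hρ0 (j + 1)).le inter_subset_right).trans ?_
    rw [h0]; simp
  have := toReal_mul_le_of_gridMap (Nat.le_succ d) zero_le_one (by positivity) (hρ0 (j + 1)).le hδ0
    hstep.le (hKρ (j + 1)) ((hmono _).trans_lt hfin) (hmin _ (hρ0 _) (hρR _)) hV hskel
  rw [← hA] at this
  set x := (μH[(d : ℝ)] (E ∩ Metric.closedBall z (ρ j))).toReal
  set x' := (μH[(d : ℝ)] (E ∩ Metric.closedBall z (ρ (j + 1)))).toReal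
  have h5 : ρ (j + 1) ^ d ≤ R ^ d * q ^ j := by
    have : ρ (j + 1) ^ d ≤ R ^ d := pow_le_pow_left₀ (hρ0 _).le (hρR _) d
    have h6 : 0 ≤ R ^ d := by positivity
    nlinarith
  have h7 : (1 + A) * x ≤ A * x' + B * R ^ d * q ^ j := by
    refine this.trans ?_
    rw [hB]; linarith
  have h8 : x ≤ (A * x' + B * R ^ d * q ^ j) / (1 + A) := by
    rw [le_div_iff₀ (by linarith)]; linarith
  refine h8.trans ?_
  rw [add_div, hθ, mul_div_right_comm]
  gcongr
  exact div_le_self (by positivity) (by linarith)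

/-- A set of finite measure with small upper density at all its points is a null set. -/
lemma hausdorffMeasure_eq_zero_of_density {X : Type*} [MetricSpace X] [MeasurableSpace X]
    [BorelSpace X] {d : ℕ} (hd : 0 < d) {A : Set X} (hA : MeasurableSet A)
    (hfin : μH[(d : ℝ)] A < ∞) {r₀ : ℝ} (hr₀ : 0 < r₀)
    (h : ∀ y ∈ A, ∀ r, 0 < r → r ≤ r₀ →
      2 * μH[(d : ℝ)] (A ∩ Metric.closedBall y r) ≤ ENNReal.ofReal r ^ d) :
    μH[(d : ℝ)] A = 0 := by
  have hle : (2 : ℝ≥0∞) • μH[(d : ℝ)].restrict A ≤ μH[(d : ℝ)] := by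
    refine Measure.le_hausdorffMeasure _ _ (ENNReal.ofReal r₀) (by simpa using hr₀) fun s hs => ?_
    rw [Measure.smul_apply, Measure.restrict_apply' hA, smul_eq_mul, ENNReal.rpow_natCast]
    rcases (s ∩ A).eq_empty_or_nonempty with h0 | ⟨y, hys, hyA⟩
    · simp [h0]
    have hne : Metric.ediam s ≠ ∞ := (hs.trans_lt ENNReal.ofReal_lt_top).ne
    rcases eq_or_ne (Metric.ediam s) 0 with h0 | h0
    · have hsub : (s ∩ A).Subsingleton := (Metric.ediam_eq_zero_iff.1 h0).anti inter_subset_left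
      have := Measure.nullSingletonClass_hausdorff X (d := (d : ℝ)) (by exact_mod_cast hd)
      rw [hsub.measure_zero, mul_zero]; exact zero_le
    · set D := (Metric.ediam s).toReal
      have hD : ENNReal.ofReal D = Metric.ediam s := ENNReal.ofReal_toReal hne
      have hD0 : 0 < D := ENNReal.toReal_pos h0 hne
      have hDr : D ≤ r₀ := ENNReal.toReal_le_of_le_ofReal hr₀.le hs
      rw [← hD]
      refine le_trans ?_ (h y hyA D hD0 hDr)
      refine mul_le_mul_right (measure_mono ?_) _
      rintro x ⟨hx, hxA⟩
      refine ⟨hxA, ?_⟩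
      rw [Metric.mem_closedBall, ← ENNReal.ofReal_le_ofReal_iff hD0.le, hD, ← edist_dist]
      exact Metric.edist_le_ediam_of_mem hx hys
  have h2 := hle A
  rw [Measure.smul_apply, Measure.restrict_apply' hA, inter_self, smul_eq_mul] at h2
  by_contra hne
  have := ENNReal.toReal_mono hfin.ne h2
  rw [ENNReal.toReal_mul, ENNReal.toReal_ofNat] at this
  have := ENNReal.toReal_pos hne hfin.ne
  linarith

/-- If the density of an almost minimal set in a ball is small enough, then it is not larger in the
concentric ball of half the radius: such a set can be deformed to the `k`-skeleton of a grid
of comparable mesh, and this skeleton is a null set. -/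
lemma exists_density_half_le (n k : ℕ) : ∃ c : ℝ, 0 < c ∧ 2 * (2 ^ (k + 1) * c) ≤ 1 ∧ ∃ η : ℝ, 0 < η ∧
    ∀ (E : Set (EuclideanSpace ℝ (Fin n))) (z : EuclideanSpace ℝ (Fin n)) (R : ℝ), 0 < R →
      IsCompact (E ∩ Metric.closedBall z R) →
      (∀ ρ, 0 < ρ → ρ ≤ R → AlmostMinIn (k + 1) (ENNReal.ofReal η) E z ρ) →
      μH[((k + 1 : ℕ) : ℝ)] (E ∩ Metric.closedBall z R) ≤ ENNReal.ofReal (c * R ^ (k + 1)) →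
      μH[((k + 1 : ℕ) : ℝ)] (E ∩ Metric.closedBall z (R / 2)) ≤
        ENNReal.ofReal (c * (R / 2) ^ (k + 1)) := by
  set A := gridConst n (k + 1) k with hA
  have hA0 : 0 ≤ A := gridConst_nonneg n _ k
  set θ := A / (1 + A) with hθ
  have hθ0 : 0 ≤ θ := by positivity
  have hθ1 : θ < 1 := by rw [hθ, div_lt_one (by linarith)]; linarith
  obtain ⟨N₀, hN₀⟩ := exists_pow_lt_of_lt_one
    (show (0 : ℝ) < 1 / 2 * (1 / 2) ^ (k + 1) by positivity) hθ1
  set N := N₀ + 1 with hN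
  have hNθ : θ ^ N ≤ 1 / 2 * (1 / 2) ^ (k + 1) :=
    (pow_le_pow_of_le_one hθ0 hθ1.le (Nat.le_succ N₀)).trans hN₀.le
  have hNpos : (0 : ℝ) < N := by rw [hN]; positivity
  set Q : ℝ := 2 * N * (n + 3) with hQ
  have hQ0 : 0 < Q := by positivity
  set G : ℝ := 2 ^ n * (2 * Q + 3) ^ n * Q ^ (k + 1) with hG
  have hG0 : 0 < G := by positivity
  obtain ⟨c, hc0, hcG, hc2⟩ : ∃ c : ℝ, 0 < c ∧ G * c ≤ 1 / 2 ∧ 2 * (2 ^ (k + 1) * c) ≤ 1 := by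
    refine ⟨min (1 / (2 * G)) (1 / (2 * 2 ^ (k + 1))), by positivity, ?_, ?_⟩
    · calc _ ≤ G * (1 / (2 * G)) := by gcongr; exact min_le_left _ _
        _ = 1 / 2 := by field_simp
    · calc _ ≤ (2 : ℝ) * (2 ^ (k + 1) * (1 / (2 * 2 ^ (k + 1)))) := by
            gcongr; exact min_le_right _ _
        _ = 1 := by field_simp
  refine ⟨c, hc0, hc2, 1 / 2 * (1 / 2) ^ (k + 1) * c, by positivity, ?_⟩
  intro E z R hR hK hmin hle
  have hfin : μH[((k + 1 : ℕ) : ℝ)] (E ∩ Metric.closedBall z R) < ∞ :=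
    hle.trans_lt ENNReal.ofReal_lt_top
  set ρ : ℕ → ℝ := fun i => R / 2 + R / 2 * (i / N) with hρ
  have hρ0 : ∀ i, 0 < ρ i := fun i => by simp only [hρ]; positivity
  have hρR : ∀ i ≤ N, ρ i ≤ R := fun i hi => by
    have : (i : ℝ) / N ≤ 1 := by rw [div_le_one hNpos]; exact_mod_cast hi
    simp only [hρ]; nlinarith
  set δ : ℝ := R / Q with hδ
  have hδ0 : 0 < δ := by positivity
  have hmono : ∀ i ≤ N, μH[((k + 1 : ℕ) : ℝ)] (E ∩ Metric.closedBall z (ρ i)) ≤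
      μH[((k + 1 : ℕ) : ℝ)] (E ∩ Metric.closedBall z R) := fun i hi =>
    measure_mono (inter_subset_inter_right _ (Metric.closedBall_subset_closedBall (hρR i hi)))
  have key := le_pow_mul_add_of_mul_le (f := fun i => (μH[((k + 1 : ℕ) : ℝ)]
    (E ∩ Metric.closedBall z (ρ i))).toReal) (A := A)
    (e := 1 / 2 * (1 / 2) ^ (k + 1) * c * R ^ (k + 1)) hA0 (N := N) fun i hi => by
      have hi' : i + 1 ≤ N := hi
      have hKρ : IsCompact (E ∩ Metric.closedBall z (ρ (i + 1))) := by
        have := hK.inter_right (Metric.isClosed_closedBall (x := z) (ε := ρ (i + 1)))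
        rwa [inter_assoc, inter_eq_self_of_subset_right
          (Metric.closedBall_subset_closedBall (hρR _ hi'))] at this
      have hstep : ρ i + (n + 3) * δ = ρ (i + 1) := by
        simp only [hρ, hδ, hQ]; push_cast; field_simp; ring
      have hV : volume {v : Fin n → ℝ | v ∈ Icc (0 : Fin n → ℝ) 1 ∧
          ∃ y ∈ E ∩ Metric.closedBall z (ρ (i + 1)), dualDist k (gridCoord δ v y) = 0} ≤ 1 / 2 := by
        refine (volume_dualDist_eq_zero_le k hδ0 hR.le (z := z) (inter_subset_right.trans
          (Metric.closedBall_subset_closedBall (hρR _ hi')))).trans ?_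
        have h1 : 2 * R / δ + 3 = 2 * Q + 3 := by rw [hδ]; field_simp
        have h2 : δ⁻¹ ^ (k + 1) * (c * R ^ (k + 1)) = Q ^ (k + 1) * c := by
          rw [hδ, inv_div, div_pow]; field_simp
        calc _ ≤ 2 ^ n * ENNReal.ofReal (2 * R / δ + 3) ^ n *
              (ENNReal.ofReal δ⁻¹ ^ (k + 1) * ENNReal.ofReal (c * R ^ (k + 1))) := by
              gcongr
              exact (hmono _ hi').trans hle
          _ = ENNReal.ofReal (G * c) := by
              rw [h1, ← ENNReal.ofReal_pow (by positivity), ← ENNReal.ofReal_pow (by positivity),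
                ← ENNReal.ofReal_mul (by positivity), h2, hG, mul_assoc _ (Q ^ (k + 1)) c,
                ENNReal.ofReal_mul (p := 2 ^ n * (2 * Q + 3) ^ n) (by positivity),
                ENNReal.ofReal_mul (p := 2 ^ n) (by positivity),
                ENNReal.ofReal_pow (p := 2) (by positivity)]
              simp
          _ ≤ ENNReal.ofReal (1 / 2) := ENNReal.ofReal_le_ofReal hcG
          _ = 1 / 2 := by
              rw [ENNReal.ofReal_div_of_pos (by norm_num)]; simp
      have := toReal_mul_le_of_gridMap le_rfl (η := 1 / 2 * (1 / 2) ^ (k + 1) * c) (by positivity)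
        le_rfl (hρ0 (i + 1)).le hδ0
        hstep.le hKρ ((hmono _ hi').trans_lt hfin) (hmin _ (hρ0 _) (hρR _ hi')) hV
        (fun v => by
          rw [measure_mono_null inter_subset_left
            (hausdorffMeasure_gridSkeleton_eq_zero (Nat.lt_succ_self k) δ v)]
          exact zero_le)
      refine this.trans ?_
      rw [zero_add]
      have h3 : ρ (i + 1) ^ (k + 1) ≤ R ^ (k + 1) :=
        pow_le_pow_left₀ (hρ0 _).le (hρR _ hi') _
      gcongr
  have e0 : ρ 0 = R / 2 := by simp [hρ]
  have eN : ρ N = R := by simp only [hρ]; rw [div_self hNpos.ne']; ring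
  simp only [e0, eN] at key
  rw [← hθ] at key
  have h1 := ENNReal.toReal_le_of_le_ofReal (by positivity) hle
  have h2 : (μH[((k + 1 : ℕ) : ℝ)] (E ∩ Metric.closedBall z (R / 2))).toReal ≤
      c * (R / 2) ^ (k + 1) := by
    refine key.trans ?_
    have h3 : θ ^ N * (μH[((k + 1 : ℕ) : ℝ)] (E ∩ Metric.closedBall z R)).toReal ≤
        1 / 2 * (1 / 2) ^ (k + 1) * (c * R ^ (k + 1)) := by gcongr
    have h4 : (1 - θ ^ N) * (1 / 2 * (1 / 2) ^ (k + 1) * c * R ^ (k + 1)) ≤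
        1 / 2 * (1 / 2) ^ (k + 1) * c * R ^ (k + 1) :=
      mul_le_of_le_one_left (by positivity) (by linarith [pow_nonneg hθ0 N])
    have h5 : c * (R / 2) ^ (k + 1) = (1 / 2) ^ (k + 1) * c * R ^ (k + 1) := by
      rw [div_eq_mul_one_div, mul_pow]; ring
    linarith
  have h6 : μH[((k + 1 : ℕ) : ℝ)] (E ∩ Metric.closedBall z (R / 2)) ≠ ∞ := by
    refine ((measure_mono (inter_subset_inter_right _
      (Metric.closedBall_subset_closedBall ?_))).trans_lt hfin).ne
    linarith
  exact (ENNReal.le_ofReal_iff_toReal_le h6 (by positivity)).2 h2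

/-- **Lower mass bound.** A coral almost minimal set of dimension `k + 1` has mass at least
`c R ^ (k + 1)` in the balls of radius `R` centered on it. -/
lemma exists_le_hausdorffMeasure (n k : ℕ) : ∃ c : ℝ, 0 < c ∧ ∃ η : ℝ, 0 < η ∧
    ∀ (E : Set (EuclideanSpace ℝ (Fin n))) (z : EuclideanSpace ℝ (Fin n)) (R : ℝ), 0 < R →
      IsCompact (E ∩ Metric.closedBall z R) →
      μH[((k + 1 : ℕ) : ℝ)] (E ∩ Metric.closedBall z R) < ∞ →
      (∀ y ρ, 0 < ρ → ρ ≤ R → Metric.closedBall y ρ ⊆ Metric.closedBall z R →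
        AlmostMinIn (k + 1) (ENNReal.ofReal η) E y ρ) →
      0 < μH[((k + 1 : ℕ) : ℝ)] (E ∩ Metric.closedBall z (R / 2)) →
      c * R ^ (k + 1) ≤ (μH[((k + 1 : ℕ) : ℝ)] (E ∩ Metric.closedBall z R)).toReal := by
  obtain ⟨c, hc0, hc2, η, hη, H⟩ := exists_density_half_le n k
  refine ⟨c * (1 / 2) ^ (k + 1), by positivity, η, hη, ?_⟩
  intro E z R hR hK hfin hmin hpos
  by_contra! hlt
  have hsub : ∀ y ∈ Metric.closedBall z (R / 2), ∀ ρ ≤ R / 2,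
      Metric.closedBall y ρ ⊆ Metric.closedBall z R := fun y hy ρ hρ =>
    Metric.closedBall_subset_closedBall' (by
      have := Metric.mem_closedBall.1 hy; linarith)
  -- all densities at dyadic scales are at most `c`
  have hdyad : ∀ y ∈ Metric.closedBall z (R / 2), ∀ j : ℕ,
      μH[((k + 1 : ℕ) : ℝ)] (E ∩ Metric.closedBall y (R / 2 * (1 / 2) ^ j)) ≤
        ENNReal.ofReal (c * (R / 2 * (1 / 2) ^ j) ^ (k + 1)) := by
    intro y hy j
    induction j with
    | zero =>
      rw [pow_zero, mul_one]
      have h1 : μH[((k + 1 : ℕ) : ℝ)] (E ∩ Metric.closedBall z R) ≤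
          ENNReal.ofReal (c * (R / 2) ^ (k + 1)) := by
        refine (ENNReal.le_ofReal_iff_toReal_le hfin.ne (by positivity)).2 (hlt.le.trans_eq ?_)
        rw [div_eq_mul_one_div R 2, mul_pow R]; ring
      exact (measure_mono (inter_subset_inter_right _ (hsub y hy _ le_rfl))).trans h1
    | succ j ih =>
      have hj : R / 2 * (1 / 2) ^ j ≤ R / 2 :=
        mul_le_of_le_one_right (by positivity) (pow_le_one₀ (by norm_num) (by norm_num))
      have e : R / 2 * (1 / 2) ^ (j + 1) = R / 2 * (1 / 2) ^ j / 2 := by rw [pow_succ]; ring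
      rw [e]
      refine H E y _ (by positivity) ?_ (fun ρ hρ hρ' =>
        hmin y ρ hρ (by linarith) (hsub y hy ρ (hρ'.trans hj))) ih
      have := hK.inter_right (Metric.isClosed_closedBall (x := y) (ε := R / 2 * (1 / 2) ^ j))
      rwa [inter_assoc, inter_eq_self_of_subset_right (hsub y hy _ hj)] at this
  have hR2 : Metric.closedBall z (R / 2) ⊆ Metric.closedBall z R :=
    Metric.closedBall_subset_closedBall (by linarith)
  have hKA : IsCompact (E ∩ Metric.closedBall z (R / 2)) := by
    have := hK.inter_right (Metric.isClosed_closedBall (x := z) (ε := R / 2))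
    rwa [inter_assoc, inter_eq_self_of_subset_right hR2] at this
  refine hpos.ne' (hausdorffMeasure_eq_zero_of_density k.succ_pos hKA.isClosed.measurableSet
    ((measure_mono (inter_subset_inter_right _ hR2)).trans_lt hfin) (r₀ := R / 2) (by positivity)
    fun y hy r hr hrR => ?_)
  obtain ⟨j, hj, hj'⟩ := exists_nat_pow_near_of_lt_one (x := r / (R / 2)) (y := 1 / 2)
    (by positivity) (by rwa [div_le_one (by positivity)]) (by norm_num) (by norm_num)
  rw [div_le_iff₀ (by positivity), mul_comm] at hj'
  rw [lt_div_iff₀ (by positivity), pow_succ] at hj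
  have h1 : μH[((k + 1 : ℕ) : ℝ)] ((E ∩ Metric.closedBall z (R / 2)) ∩ Metric.closedBall y r) ≤
      ENNReal.ofReal (c * (2 * r) ^ (k + 1)) := by
    refine (measure_mono ?_).trans ((hdyad y hy.2 j).trans (ENNReal.ofReal_le_ofReal ?_))
    · rintro x ⟨⟨hx, -⟩, hxr⟩
      exact ⟨hx, Metric.closedBall_subset_closedBall hj' hxr⟩
    · refine mul_le_mul_of_nonneg_left (pow_le_pow_left₀ (by positivity) ?_ _) hc0.le
      linarith
  calc _ ≤ 2 * ENNReal.ofReal (c * (2 * r) ^ (k + 1)) := by gcongr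
    _ = ENNReal.ofReal (2 * (2 ^ (k + 1) * c) * r ^ (k + 1)) := by
        rw [show (2 : ℝ≥0∞) = ENNReal.ofReal 2 by simp, ← ENNReal.ofReal_mul (by norm_num), mul_pow]
        congr 1; ring
    _ ≤ ENNReal.ofReal (r ^ (k + 1)) :=
        ENNReal.ofReal_le_ofReal (mul_le_of_le_one_left (by positivity) hc2)
    _ = _ := ENNReal.ofReal_pow hr.le _

end bounds

/-! ### Decay of the mass of a flat set around a hole -/

section hole

variable {n : ℕ}

/-- The normalization of `μHE[d]` does not depend on the space. -/
lemma exists_euclideanHausdorffMeasure_eq_mul (d : ℕ) : ∃ c : ℝ≥0∞, c ≠ 0 ∧ c ≠ ∞ ∧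
    ∀ (X : Type) [EMetricSpace X] [MeasurableSpace X] [BorelSpace X] (s : Set X),
      μHE[d] s = c * μH[(d : ℝ)] s := by
  refine ⟨Measure.addHaarScalarFactor (volume : Measure (EuclideanSpace ℝ (Fin d))) μH[d], ?_,
    ENNReal.coe_ne_top, fun X _ _ _ s => ?_⟩
  · exact_mod_cast Measure.addHaarScalarFactor_volume_hausdorffMeasure_ne_zero d
  · rw [Measure.euclideanHausdorffMeasure_def, Measure.smul_apply]; rfl

lemma hausdorffMeasure_sphere_eq_zero {d : ℕ} (W : Submodule ℝ (EuclideanSpace ℝ (Fin n)))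
    (hW : Module.finrank ℝ W = d) (z : EuclideanSpace ℝ (Fin n)) {ρ : ℝ} (hρ : 0 < ρ) :
    μH[(d : ℝ)] {y : EuclideanSpace ℝ (Fin n) | ∃ w ∈ W, ‖w‖ = ρ ∧ y = z + w} = 0 := by
  obtain ⟨c, hc0, hct, hc⟩ := exists_euclideanHausdorffMeasure_eq_mul d
  have hiso : Isometry fun w : W => z + (w : EuclideanSpace ℝ (Fin n)) :=
    Isometry.of_dist_eq fun w w' => by simp [Subtype.dist_eq]
  have himg : {y : EuclideanSpace ℝ (Fin n) | ∃ w ∈ W, ‖w‖ = ρ ∧ y = z + w} =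
      (fun w : W => z + (w : EuclideanSpace ℝ (Fin n))) '' Metric.sphere 0 ρ := by
    ext y
    constructor
    · rintro ⟨w, hw, hn, rfl⟩
      exact ⟨⟨w, hw⟩, by simpa using hn, rfl⟩
    · rintro ⟨w, hw, rfl⟩
      exact ⟨w, w.2, by simpa using hw, rfl⟩
  rw [himg, hiso.hausdorffMeasure_image (Or.inl (Nat.cast_nonneg d))]
  have h1 : μHE[d] (Metric.sphere (0 : W) ρ) = 0 := by
    rw [← hW, InnerProductSpace.euclideanHausdorffMeasure_eq_volume]
    exact Measure.addHaar_sphere_of_ne_zero _ _ hρ.ne'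
  rw [hc] at h1
  exact (mul_eq_zero.1 h1).resolve_left hc0

variable (W : Submodule ℝ (EuclideanSpace ℝ (Fin n))) (z : EuclideanSpace ℝ (Fin n))

/-- Pushes the points `y` close to `z + W`, except those projecting to `z`: if
`‖proj (y - z)‖ ≤ ρ`, to the sphere of radius `ρ` of the plane `z + W`; if
`ρ ≤ ‖proj (y - z)‖`, towards the plane `z + W` only, and not at all when
`ρ + w ≤ ‖proj (y - z)‖`. -/
noncomputable def holePush (ρ w : ℝ) (y : EuclideanSpace ℝ (Fin n)) : EuclideanSpace ℝ (Fin n) :=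
  z + max 1 (ρ / ‖W.starProjection (y - z)‖) • W.starProjection (y - z) +
    unitClamp ((‖W.starProjection (y - z)‖ - ρ) / w) • (y - z - W.starProjection (y - z))

variable {W z} {ρ w : ℝ}

lemma holePush_of_le {y : EuclideanSpace ℝ (Fin n)} (hρ : 0 < ρ) (hw : 0 < w)
    (h : ρ + w ≤ ‖W.starProjection (y - z)‖) : holePush W z ρ w y = y := by
  unfold holePush
  rw [unitClamp_of_one_le (by rw [le_div_iff₀ hw]; linarith), max_eq_left
    (by rw [div_le_one (by linarith)]; linarith)]
  simp

lemma holePush_mem_sphere {y : EuclideanSpace ℝ (Fin n)} (hρ : 0 < ρ) (hw : 0 < w)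
    (h0 : W.starProjection (y - z) ≠ 0) (h : ‖W.starProjection (y - z)‖ ≤ ρ) :
    ∃ w' ∈ W, ‖w'‖ = ρ ∧ holePush W z ρ w y = z + w' := by
  have hp := norm_pos_iff.2 h0
  refine ⟨(ρ / ‖W.starProjection (y - z)‖) • W.starProjection (y - z),
    W.smul_mem _ (Submodule.starProjection_apply_mem _ _), ?_, ?_⟩
  · rw [norm_smul, Real.norm_of_nonneg (by positivity)]; field_simp
  · unfold holePush
    rw [unitClamp_of_nonpos (div_nonpos_of_nonpos_of_nonneg (by linarith) hw.le),
      max_eq_right (by rwa [one_le_div hp]), zero_smul, add_zero]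

lemma norm_holePush_sub_le {y : EuclideanSpace ℝ (Fin n)}
    (h0 : W.starProjection (y - z) ≠ 0) :
    ‖holePush W z ρ w y - z‖ ≤
      max ‖W.starProjection (y - z)‖ ρ + ‖y - z - W.starProjection (y - z)‖ := by
  have hp := norm_pos_iff.2 h0
  unfold holePush
  rw [add_assoc, add_sub_cancel_left]
  refine (norm_add_le _ _).trans (add_le_add ?_ ?_)
  · rw [norm_smul, Real.norm_of_nonneg (by positivity), max_mul_of_nonneg _ _ hp.le, one_mul,
      div_mul_cancel₀ _ hp.ne']
  · rw [norm_smul, Real.norm_of_nonneg (unitClamp_nonneg _)]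
    exact mul_le_of_le_one_left (norm_nonneg _) (unitClamp_le_one _)

lemma norm_starProjection_sub_le (y y' : EuclideanSpace ℝ (Fin n)) :
    ‖W.starProjection (y - z) - W.starProjection (y' - z)‖ ≤ dist y y' := by
  rw [← map_sub, sub_sub_sub_cancel_right, dist_eq_norm]
  exact Submodule.norm_starProjection_apply_le _ _

/-- The component of `holePush` orthogonal to `W` has a bounded Lipschitz constant. -/
lemma norm_unitClamp_smul_sub_le {y y' : EuclideanSpace ℝ (Fin n)} (hw : 0 < w)
    (hy' : ‖y' - z - W.starProjection (y' - z)‖ ≤ w) :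
    ‖unitClamp ((‖W.starProjection (y - z)‖ - ρ) / w) • (y - z - W.starProjection (y - z)) -
      unitClamp ((‖W.starProjection (y' - z)‖ - ρ) / w) • (y' - z - W.starProjection (y' - z))‖ ≤
      3 * dist y y' := by
  have hpp := norm_starProjection_sub_le (W := W) (z := z) y y'
  set p := W.starProjection (y - z)
  set p' := W.starProjection (y' - z)
  set s := unitClamp ((‖p‖ - ρ) / w)
  set s' := unitClamp ((‖p'‖ - ρ) / w)
  have e : s • (y - z - p) - s' • (y' - z - p') =
      s • ((y - y') - (p - p')) + (s - s') • (y' - z - p') := by module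
  have hss : |s - s'| ≤ dist y y' / w := by
    refine (abs_unitClamp_sub_le _ _).trans ?_
    rw [← sub_div, sub_sub_sub_cancel_right, abs_div, abs_of_pos hw]
    exact div_le_div_of_nonneg_right ((abs_norm_sub_norm_le p p').trans hpp) hw.le
  have hs0 : 0 ≤ s := unitClamp_nonneg _
  have h1 : ‖s • ((y - y') - (p - p'))‖ ≤ 2 * dist y y' := by
    rw [norm_smul, Real.norm_of_nonneg hs0]
    refine (mul_le_of_le_one_left (norm_nonneg _) (unitClamp_le_one _)).trans
      ((norm_sub_le _ _).trans ?_)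
    rw [← dist_eq_norm y y']; linarith
  have h2 : ‖(s - s') • (y' - z - p')‖ ≤ dist y y' := by
    rw [norm_smul, Real.norm_eq_abs]
    calc _ ≤ dist y y' / w * w := by gcongr
      _ = _ := by field_simp
  rw [e]
  refine (norm_add_le _ _).trans ?_
  linarith

lemma dist_holePush_le_four_mul {y y' : EuclideanSpace ℝ (Fin n)} (hρ : 0 < ρ) (hw : 0 < w)
    (hy' : ‖y' - z - W.starProjection (y' - z)‖ ≤ w)
    (h : ρ ≤ ‖W.starProjection (y - z)‖) (h' : ρ ≤ ‖W.starProjection (y' - z)‖) :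
    dist (holePush W z ρ w y) (holePush W z ρ w y') ≤ 4 * dist y y' := by
  have h1 := norm_unitClamp_smul_sub_le (ρ := ρ) (y := y) hw hy'
  have h2 := norm_starProjection_sub_le (W := W) (z := z) y y'
  rw [dist_eq_norm]
  unfold holePush
  rw [max_eq_left (by rw [div_le_one (by linarith)]; exact h), max_eq_left
    (by rw [div_le_one (by linarith)]; exact h'), one_smul, one_smul, add_sub_add_comm,
    add_sub_add_left_eq_sub]
  refine (norm_add_le _ _).trans ?_
  linarith

lemma dist_holePush_le {y y' : EuclideanSpace ℝ (Fin n)} {κ R : ℝ} (hρ : 0 < ρ) (hw : 0 < w)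
    (hκ : 0 < κ) (hy' : ‖y' - z - W.starProjection (y' - z)‖ ≤ w)
    (h : κ ≤ ‖W.starProjection (y - z)‖) (h' : κ ≤ ‖W.starProjection (y' - z)‖)
    (hR' : ‖W.starProjection (y' - z)‖ ≤ R) :
    dist (holePush W z ρ w y) (holePush W z ρ w y') ≤
      (1 + ρ / κ + ρ / κ ^ 2 * R + 3) * dist y y' := by
  have h1 := norm_unitClamp_smul_sub_le (ρ := ρ) (y := y) hw hy'
  have h2 := norm_starProjection_sub_le (W := W) (z := z) y y'
  rw [dist_eq_norm]
  unfold holePush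
  rw [add_sub_add_comm, add_sub_add_left_eq_sub]
  refine (norm_add_le _ _).trans ?_
  set p := W.starProjection (y - z)
  set p' := W.starProjection (y' - z)
  have e : max 1 (ρ / ‖p‖) • p - max 1 (ρ / ‖p'‖) • p' =
      max 1 (ρ / ‖p‖) • (p - p') + (max 1 (ρ / ‖p‖) - max 1 (ρ / ‖p'‖)) • p' := by module
  have h3 : max 1 (ρ / ‖p‖) ≤ 1 + ρ / κ := by
    have h4 : ρ / ‖p‖ ≤ ρ / κ := by gcongr
    have h5 : 0 ≤ ρ / κ := by positivity
    exact max_le (by linarith) (by linarith)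
  have h4 : |max 1 (ρ / ‖p‖) - max 1 (ρ / ‖p'‖)| ≤ ρ / κ ^ 2 * dist y y' := by
    refine (abs_max_sub_max_le_max _ _ _ _).trans (max_le (by simp; positivity) ?_)
    have hp : 0 < ‖p‖ := hκ.trans_le h
    have hp' : 0 < ‖p'‖ := hκ.trans_le h'
    have e2 : ρ / ‖p‖ - ρ / ‖p'‖ = ρ / (‖p‖ * ‖p'‖) * (‖p'‖ - ‖p‖) := by field_simp
    rw [e2, abs_mul, abs_of_pos (by positivity)]
    have h6 : |‖p'‖ - ‖p‖| ≤ dist y y' := by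
      rw [abs_sub_comm]; exact (abs_norm_sub_norm_le p p').trans h2
    have h7 : κ ^ 2 ≤ ‖p‖ * ‖p'‖ := by rw [sq]; gcongr
    gcongr
  have h5 : ‖max 1 (ρ / ‖p‖) • p - max 1 (ρ / ‖p'‖) • p'‖ ≤
      (1 + ρ / κ) * dist y y' + ρ / κ ^ 2 * dist y y' * R := by
    rw [e]
    refine (norm_add_le _ _).trans (add_le_add ?_ ?_)
    · rw [norm_smul, Real.norm_of_nonneg (by positivity)]
      gcongr
    · rw [norm_smul, Real.norm_eq_abs]
      gcongr
  linarith

/-- If the almost minimal set `E` is `w`-close to the `d`-plane `z + W` and does not project onto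
`z`, then the part of `E` over the ball of radius `ρ` of the plane can be sent to a
`(d - 1)`-sphere, at the cost of a bounded expansion of the part over the surrounding
annulus of width `w`. -/
lemma toReal_mul_le_of_hole {d : ℕ} (hW : Module.finrank ℝ W = d)
    {E : Set (EuclideanSpace ℝ (Fin n))} {R η : ℝ} (hη : 0 ≤ η) (hρ : 0 < ρ) (hw : 0 < w)
    (hR : ρ + w + w < R) (hK : IsCompact (E ∩ Metric.closedBall z R))
    (hfin : μH[(d : ℝ)] (E ∩ Metric.closedBall z R) < ∞)
    (hmin : AlmostMinIn d (ENNReal.ofReal η) E z R)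
    (hflat : ∀ y ∈ E ∩ Metric.closedBall z R, ‖y - z - W.starProjection (y - z)‖ ≤ w)
    (hhole : ∀ y ∈ E ∩ Metric.closedBall z R, W.starProjection (y - z) ≠ 0) :
    (1 + 4 ^ d) * (μH[(d : ℝ)] (E ∩ Metric.closedBall z R ∩
        {y | ‖W.starProjection (y - z)‖ ≤ ρ})).toReal ≤
      4 ^ d * (μH[(d : ℝ)] (E ∩ Metric.closedBall z R ∩
        {y | ‖W.starProjection (y - z)‖ ≤ ρ + w})).toReal + η * R ^ d := by
  set K := E ∩ Metric.closedBall z R with hKdef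
  have hpc : Continuous fun y => ‖W.starProjection (y - z)‖ := by fun_prop
  have hpn : ∀ y ∈ K, ‖W.starProjection (y - z)‖ ≤ R := fun y hy =>
    (Submodule.norm_starProjection_apply_le _ _).trans (by
      rw [← dist_eq_norm]; exact hy.2)
  obtain ⟨κ, hκ, hκK⟩ := hK.exists_forall_le' hpc.continuousOn
    (fun y hy => norm_pos_iff.2 (hhole y hy))
  have hR0 : 0 < R := by linarith
  have hcomp := hmin (holePush W z ρ w) ⟨_, fun y hy y' hy' =>
      dist_holePush_le hρ hw hκ (hflat y' hy') (hκK y hy) (hκK y' hy') (hpn y' hy')⟩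
    ⟨ρ + w + w, hR, fun y hy h => holePush_of_le hρ hw (by
      have h1 := norm_sub_norm_le (y - z) (W.starProjection (y - z))
      have h2 := hflat y hy
      rw [← dist_eq_norm] at h1
      linarith)⟩ (fun y hy => by
      rcases le_or_gt (ρ + w) ‖W.starProjection (y - z)‖ with h | h
      · rw [holePush_of_le hρ hw h]; exact hy.2
      · rw [Metric.mem_closedBall, dist_eq_norm]
        have h1 := norm_holePush_sub_le (ρ := ρ) (w := w) (hhole y hy)
        have h2 := hflat y hy
        have h3 : max ‖W.starProjection (y - z)‖ ρ ≤ ρ + w := max_le h.le (by linarith)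
        linarith)
  have hm : ∀ t, MeasurableSet {y : EuclideanSpace ℝ (Fin n) | ‖W.starProjection (y - z)‖ ≤ t} :=
    fun t => (isClosed_le hpc continuous_const).measurableSet
  set S : ℝ → Set (EuclideanSpace ℝ (Fin n)) := fun t => {y | ‖W.starProjection (y - z)‖ ≤ t}
    with hS
  have himage : holePush W z ρ w '' K ⊆
      {y : EuclideanSpace ℝ (Fin n) | ∃ w ∈ W, ‖w‖ = ρ ∧ y = z + w} ∪
        holePush W z ρ w '' ((K ∩ S (ρ + w)) \ S ρ) ∪ (K \ S (ρ + w)) := by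
    rintro _ ⟨y, hy, rfl⟩
    rcases le_or_gt ‖W.starProjection (y - z)‖ ρ with h | h
    · exact Or.inl (Or.inl (holePush_mem_sphere hρ hw (hhole y hy) h))
    · rcases le_or_gt ‖W.starProjection (y - z)‖ (ρ + w) with h2 | h2
      · exact Or.inl (Or.inr ⟨y, ⟨⟨hy, h2⟩, not_le.2 h⟩, rfl⟩)
      · rw [holePush_of_le hρ hw h2.le]
        exact Or.inr ⟨hy, not_le.2 h2⟩
  have hann : μH[(d : ℝ)] (holePush W z ρ w '' ((K ∩ S (ρ + w)) \ S ρ)) ≤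
      4 ^ d * μH[(d : ℝ)] ((K ∩ S (ρ + w)) \ S ρ) := by
    have hlip : LipschitzOnWith 4 (holePush W z ρ w) ((K ∩ S (ρ + w)) \ S ρ) :=
      LipschitzOnWith.of_dist_le_mul fun y hy y' hy' =>
        dist_holePush_le_four_mul hρ hw (hflat y' hy'.1.1) (not_le.1 hy.2).le (not_le.1 hy'.2).le
    have := hlip.hausdorffMeasure_image_le (Nat.cast_nonneg d)
    rwa [ENNReal.rpow_natCast] at this
  have hsplit1 := measure_inter_add_sdiff (μ := μH[(d : ℝ)]) K (hm (ρ + w))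
  have hsplit2 := measure_inter_add_sdiff (μ := μH[(d : ℝ)]) (K ∩ S (ρ + w)) (hm ρ)
  change μH[(d : ℝ)] (K ∩ S (ρ + w)) + μH[(d : ℝ)] (K \ S (ρ + w)) = _ at hsplit1
  change μH[(d : ℝ)] ((K ∩ S (ρ + w)) ∩ S ρ) + μH[(d : ℝ)] ((K ∩ S (ρ + w)) \ S ρ) = _ at hsplit2
  have hSS : K ∩ S (ρ + w) ∩ S ρ = K ∩ S ρ := by
    rw [inter_assoc]
    refine congrArg (K ∩ ·) (inter_eq_self_of_subset_right ?_)
    intro y (hy : ‖W.starProjection (y - z)‖ ≤ ρ)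
    exact hy.trans (by linarith)
  rw [hSS] at hsplit2
  have hf : ∀ s ⊆ K, μH[(d : ℝ)] s ≠ ∞ := fun s hs => ((measure_mono hs).trans_lt hfin).ne
  have h1 := hf (K ∩ S ρ) inter_subset_left
  have h2 := hf ((K ∩ S (ρ + w)) \ S ρ) (sdiff_subset.trans inter_subset_left)
  have h3 := hf (K \ S (ρ + w)) sdiff_subset
  have hle : μH[(d : ℝ)] (K ∩ S (ρ + w)) ≤
      4 ^ d * μH[(d : ℝ)] ((K ∩ S (ρ + w)) \ S ρ) + ENNReal.ofReal η * ENNReal.ofReal R ^ d := by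
    refine (ENNReal.add_le_add_iff_right h3).1 ?_
    rw [hsplit1]
    refine hcomp.trans ?_
    have h4 := (measure_mono himage).trans ((measure_union_le _ _).trans
      (add_le_add_left (measure_union_le _ _) (μH[(d : ℝ)] (K \ S (ρ + w)))))
    rw [hausdorffMeasure_sphere_eq_zero W hW z hρ, zero_add] at h4
    calc _ ≤ 4 ^ d * μH[(d : ℝ)] ((K ∩ S (ρ + w)) \ S ρ) + μH[(d : ℝ)] (K \ S (ρ + w)) +
          ENNReal.ofReal η * ENNReal.ofReal R ^ d :=
          add_le_add_left (h4.trans (add_le_add_left hann _)) _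
      _ = _ := by ring
  set x := μH[(d : ℝ)] (K ∩ S ρ)
  set y := μH[(d : ℝ)] ((K ∩ S (ρ + w)) \ S ρ)
  change (1 + 4 ^ d) * x.toReal ≤ 4 ^ d * (μH[(d : ℝ)] (K ∩ S (ρ + w))).toReal + η * R ^ d
  rw [← hsplit2, ENNReal.toReal_add h1 h2]
  have h5 : x ≤ ENNReal.ofReal (4 ^ d * y.toReal + η * R ^ d) := by
    refine (le_self_add.trans (hsplit2.trans_le hle)).trans_eq ?_
    rw [ENNReal.ofReal_add (by positivity) (by positivity), ENNReal.ofReal_mul (by positivity),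
      ENNReal.ofReal_mul hη, ENNReal.ofReal_pow hR0.le, ENNReal.ofReal_toReal h2,
      ENNReal.ofReal_pow (by norm_num), ENNReal.ofReal_ofNat]
  have h6 := ENNReal.toReal_le_of_le_ofReal (by positivity) h5
  linarith

/-- **Decay around a hole**, by iteration of `toReal_mul_le_of_hole` on `N` annuli. -/
lemma toReal_le_of_hole {d : ℕ} (hW : Module.finrank ℝ W = d)
    {E : Set (EuclideanSpace ℝ (Fin n))} {R η : ℝ} (hη : 0 ≤ η) (hR : 0 < R) {N : ℕ} (hN : 2 ≤ N)
    (hK : IsCompact (E ∩ Metric.closedBall z R))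
    (hfin : μH[(d : ℝ)] (E ∩ Metric.closedBall z R) < ∞)
    (hmin : AlmostMinIn d (ENNReal.ofReal η) E z R)
    (hflat : ∀ y ∈ E ∩ Metric.closedBall z R,
      ‖y - z - W.starProjection (y - z)‖ ≤ R / (4 * N))
    (hhole : ∀ y ∈ E ∩ Metric.closedBall z R, W.starProjection (y - z) ≠ 0) :
    (μH[(d : ℝ)] (E ∩ Metric.closedBall z (R / 2))).toReal ≤
      (4 ^ d / (1 + 4 ^ d)) ^ N * (μH[(d : ℝ)] (E ∩ Metric.closedBall z R)).toReal +
        η * R ^ d := by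
  have hN2 : (2 : ℝ) ≤ N := by exact_mod_cast hN
  have hN0 : (0 : ℝ) < N := by linarith
  have hwR : R / (4 * N) ≤ R / 8 := by gcongr; linarith
  set F : ℝ → ℝ := fun t => (μH[(d : ℝ)] (E ∩ Metric.closedBall z R ∩
    {y | ‖W.starProjection (y - z)‖ ≤ t})).toReal with hF
  have key := le_pow_mul_add_of_mul_le (f := fun i : ℕ => F (R / 2 + i * (R / (4 * N))))
    (A := 4 ^ d) (e := η * R ^ d) (by positivity) (N := N) fun i hi => by
      have hi1 : (i : ℝ) + 1 ≤ N := by exact_mod_cast hi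
      have h1 : (i + 1 : ℝ) * (R / (4 * N)) ≤ R / 4 := by
        calc _ ≤ N * (R / (4 * N)) := by gcongr
          _ = R / 4 := by field_simp
      have := toReal_mul_le_of_hole hW hη (ρ := R / 2 + i * (R / (4 * N))) (w := R / (4 * N))
        (by positivity) (by positivity) (by linarith) hK hfin hmin hflat hhole
      have e : R / 2 + i * (R / (4 * N)) + R / (4 * N) =
        R / 2 + ((i + 1 : ℕ) : ℝ) * (R / (4 * N)) := by push_cast; ring
      rw [e] at this
      exact this
  simp only [Nat.cast_zero, zero_mul, add_zero] at key
  have hf : ∀ s ⊆ E ∩ Metric.closedBall z R, μH[(d : ℝ)] s ≠ ∞ := fun s hs =>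
    ((measure_mono hs).trans_lt hfin).ne
  have h1 : (μH[(d : ℝ)] (E ∩ Metric.closedBall z (R / 2))).toReal ≤ F (R / 2) := by
    refine ENNReal.toReal_mono (hf _ inter_subset_left) (measure_mono ?_)
    rintro y ⟨hy, hyR⟩
    refine ⟨⟨hy, Metric.closedBall_subset_closedBall (by linarith) hyR⟩, ?_⟩
    refine (Submodule.norm_starProjection_apply_le _ _).trans ?_
    rw [← dist_eq_norm]; exact hyR
  refine h1.trans (key.trans (add_le_add ?_ ?_))
  · gcongr
    exact ENNReal.toReal_mono hfin.ne (measure_mono inter_subset_left)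
  · refine mul_le_of_le_one_left (by positivity) ?_
    have : (0 : ℝ) ≤ (4 ^ d / (1 + 4 ^ d)) ^ N := by positivity
    linarith

end hole

/-! ### Almost minimal sets -/

section almostMinimal

variable {n d : ℕ} {U E : Set (EuclideanSpace ℝ (Fin n))} {h : ℝ → ℝ≥0∞}

lemma IsSlidingAlmostMinimal.isCompact_inter_closedBall {Γ : Set (EuclideanSpace ℝ (Fin n))}
    (hE : IsSlidingAlmostMinimal d Γ U h E) {z : EuclideanSpace ℝ (Fin n)} {R : ℝ}
    (hU : Metric.closedBall z R ⊆ U) : IsCompact (E ∩ Metric.closedBall z R) := by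
  refine (isCompact_closedBall z R).of_isClosed_subset ?_ inter_subset_right
  refine isClosed_of_closure_subset fun y hy => ?_
  have h1 : y ∈ Metric.closedBall z R :=
    Metric.isClosed_closedBall.closure_subset (closure_mono inter_subset_right hy)
  exact ⟨hE.closed ⟨closure_mono inter_subset_left hy, hU h1⟩, h1⟩

/-- A Lipschitz map of `E ∩ closedBall z R` to the ball, equal to the identity near the
boundary, is the endpoint of a deformation along segments. -/
lemma IsAlmostMinimal.almostMinIn (hE : IsAlmostMinimal d U h E) {c : ℝ≥0∞} (hc0 : c ≠ 0)
    (hct : c ≠ ∞) (hc : ∀ s : Set (EuclideanSpace ℝ (Fin n)), μHE[d] s = c * μH[(d : ℝ)] s)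
    {η : ℝ≥0∞} {z : EuclideanSpace ℝ (Fin n)} {R : ℝ} (hR : 0 < R)
    (hU : Metric.closedBall z R ⊆ U) (hη : h R ≤ c * η) : AlmostMinIn d η E z R := by
  classical
  rintro φ ⟨L, hL⟩ ⟨R', hR', hid⟩ hmaps
  set B := Metric.closedBall z R with hB
  set Φ : EuclideanSpace ℝ (Fin n) → EuclideanSpace ℝ (Fin n) := fun y =>
    if y ∈ B then φ y else y with hΦ
  have hΦin : ∀ y ∈ B, Φ y = φ y := fun y hy => if_pos hy
  have hΦout : ∀ y ∉ B, Φ y = y := fun y hy => if_neg hy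
  have hRR : 0 < R - R' := by linarith
  set M : ℝ := |L| + 2 * R / (R - R') + 1 with hM
  have hM1 : 1 ≤ M := by
    have : 0 ≤ 2 * R / (R - R') := by positivity
    linarith [abs_nonneg L]
  have hmix : ∀ y ∈ E, ∀ y' ∈ E, y ∈ B → y' ∉ B → dist (Φ y) (Φ y') ≤ M * dist y y' := by
    intro y hy y' hy' hyB hyB'
    rw [hΦin y hyB, hΦout y' hyB']
    rcases le_or_gt R' (dist y z) with h1 | h1
    · rw [hid y ⟨hy, hyB⟩ h1]
      exact le_mul_of_one_le_left dist_nonneg hM1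
    · have h2 : R < dist y' z := not_le.1 hyB'
      have h3 : R - R' ≤ dist y y' := by
        have := dist_triangle y' y z
        rw [dist_comm y' y] at this; linarith
      have h4 : dist (φ y) y ≤ 2 * R := by
        have h5 := dist_triangle_right (φ y) y z
        have h6 : dist (φ y) z ≤ R := hmaps y ⟨hy, hyB⟩
        have h7 : dist y z ≤ R := hyB
        linarith
      have h8 : 2 * R ≤ 2 * R / (R - R') * dist y y' := by
        calc 2 * R = 2 * R / (R - R') * (R - R') := by field_simp
          _ ≤ _ := by gcongr
      have h9 := dist_triangle (φ y) y y'
      have h10 : 0 ≤ |L| * dist y y' := by positivity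
      rw [hM, add_mul, add_mul, one_mul]; linarith
  have hlip : LipschitzOnWith (Real.toNNReal M) Φ E := by
    refine LipschitzOnWith.of_dist_le_mul fun y hy y' hy' => ?_
    rw [Real.coe_toNNReal _ (by linarith)]
    by_cases hyB : y ∈ B <;> by_cases hyB' : y' ∈ B
    · rw [hΦin y hyB, hΦin y' hyB']
      refine (hL y ⟨hy, hyB⟩ y' ⟨hy', hyB'⟩).trans ?_
      have : 0 ≤ 2 * R / (R - R') := by positivity
      gcongr
      linarith [le_abs_self L]
    · exact hmix y hy y' hy' hyB hyB'
    · rw [dist_comm (Φ y), dist_comm y]; exact hmix y' hy' y hy hyB' hyB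
    · rw [hΦout y hyB, hΦout y' hyB']
      exact le_mul_of_one_le_left dist_nonneg hM1
  set ψ : ℝ → EuclideanSpace ℝ (Fin n) → EuclideanSpace ℝ (Fin n) := fun t y =>
    (1 - t) • y + t • Φ y with hψ
  have hψ1 : ψ 1 = Φ := by ext1 y; simp [hψ]
  have hdef : IsSlidingDeformation univ E B ψ := by
    refine ⟨?_, fun y _ => by simp [hψ], fun t _ y hy => ?_, fun t ht y hy => ?_,
      fun _ _ _ _ => mem_univ _, ⟨_, hψ1 ▸ hlip⟩⟩
    · have h1 : ContinuousOn (fun p : EuclideanSpace ℝ (Fin n) × ℝ => Φ p.1) (E ×ˢ Icc (0 : ℝ) 1) :=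
        hlip.continuousOn.comp continuousOn_fst fun p hp => hp.1
      exact ((by fun_prop : Continuous fun p : EuclideanSpace ℝ (Fin n) × ℝ =>
        (1 - p.2) • p.1).continuousOn).add (continuousOn_snd.smul h1)
    · simp only [hψ, hΦout y hy.2]; module
    · simp only [hψ, hΦin y hy.2]
      exact convex_closedBall z R hy.2 (hmaps y hy) (by linarith [ht.2]) ht.1 (by ring)
  have hmin := hE.almostMin z R hR hU _ ⟨ψ, hdef, rfl⟩
  have hsub : ψ 1 '' E ∩ B ⊆ φ '' (E ∩ B) := by
    rintro _ ⟨⟨y, hy, rfl⟩, hyB⟩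
    rw [hψ1] at hyB ⊢
    by_cases h1 : y ∈ B
    · exact ⟨y, ⟨hy, h1⟩, (hΦin y h1).symm⟩
    · rw [hΦout y h1] at hyB
      exact absurd hyB h1
  rw [hc, hc] at hmin
  refine (ENNReal.mul_le_mul_iff_right hc0 hct).1 (hmin.trans ?_)
  calc _ ≤ c * μH[(d : ℝ)] (φ '' (E ∩ B)) + c * η * ENNReal.ofReal R ^ d := by gcongr
    _ = _ := by ring

end almostMinimal

open EuclideanGeometry in
lemma coe_orthogonalProjection_eq {n : ℕ} (P : AffineSubspace ℝ (EuclideanSpace ℝ (Fin n)))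
    [Nonempty P] {z : EuclideanSpace ℝ (Fin n)} (hz : z ∈ P) (y : EuclideanSpace ℝ (Fin n)) :
    (orthogonalProjection P y : EuclideanSpace ℝ (Fin n)) =
      P.direction.starProjection (y - z) + z := by
  rw [orthogonalProjection_apply_mem P hz]; rfl

/-- On a segment from a point outside of a compact set `K` to a point of `K`, there are
points outside of `K` at arbitrarily small distance from `K`. -/
lemma exists_lineMap_notMem_of_isCompact {n : ℕ} {K : Set (EuclideanSpace ℝ (Fin n))}
    (hK : IsCompact K) {z x : EuclideanSpace ℝ (Fin n)} (hz : z ∉ K) (hx : x ∈ K) {s : ℝ}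
    (hs : 0 < s) : ∃ t ∈ Icc (0 : ℝ) 1, AffineMap.lineMap z x t ∉ K ∧
      ∃ y ∈ K, dist (AffineMap.lineMap z x t) y < s := by
  have hne : K.Nonempty := ⟨x, hx⟩
  set g : ℝ → ℝ := fun t => Metric.infDist (AffineMap.lineMap z x t) K with hg
  have hgc : Continuous g := (Metric.continuous_infDist_pt K).comp (by fun_prop)
  have hg0 : 0 < g 0 := by
    simp only [hg, AffineMap.lineMap_apply_zero]
    exact (hK.isClosed.notMem_iff_infDist_pos hne).1 hz
  have hg1 : g 1 = 0 := by
    simp only [hg, AffineMap.lineMap_apply_one]; exact Metric.infDist_zero_of_mem hx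
  obtain ⟨t, ht, hgt⟩ := intermediate_value_Icc' zero_le_one hgc.continuousOn
    (show min (g 0) (s / 2) ∈ Icc (g 1) (g 0) from
      ⟨by rw [hg1]; positivity, min_le_left _ _⟩)
  refine ⟨t, ht, fun hmem => ?_, ?_⟩
  · have h1 : g t = 0 := Metric.infDist_zero_of_mem hmem
    have : 0 < min (g 0) (s / 2) := by positivity
    linarith
  · refine (Metric.infDist_lt_iff hne).1 ?_
    change g t < s
    rw [hgt]
    exact (min_le_right _ _).trans_lt (by linarith)

open EuclideanGeometry in
/-- The case of positive dimension. A point of `P` which is not in the projection of `E` is moved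
along the segment to `x` until `E` comes close to it. Around the new point, the decay of
the mass contradicts the lower mass bound, in view of the upper mass bound. -/
lemma exists_subset_image_orthogonalProjection (n k : ℕ) {h : ℝ → ℝ≥0∞} (hh : IsGauge h)
    {τ : ℝ} (hτ : 0 < τ) :
    ∃ ε : ℝ, 0 < ε ∧ ∃ r₀ : ℝ, 0 < r₀ ∧
      ∀ U E : Set (EuclideanSpace ℝ (Fin n)),
        IsAlmostMinimal (k + 1) U h E → IsCoral (k + 1) E →
        ∀ x ∈ E, ∀ r : ℝ, 0 < r → r ≤ r₀ → Metric.ball x (2 * r) ⊆ U →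
        ∀ (P : AffineSubspace ℝ (EuclideanSpace ℝ (Fin n))) [Nonempty P],
          x ∈ P → Module.finrank ℝ P.direction = k + 1 →
          (∀ y ∈ E ∩ Metric.ball x r,
            Metric.infDist y (P : Set (EuclideanSpace ℝ (Fin n))) ≤ ε * r) →
          (P : Set (EuclideanSpace ℝ (Fin n))) ∩ Metric.ball x ((1 - τ) * r) ⊆
            (fun y => (orthogonalProjection P y : EuclideanSpace ℝ (Fin n))) ''
              (E ∩ Metric.ball x r) := by
  obtain ⟨c, hc0, hct, hc⟩ := exists_euclideanHausdorffMeasure_eq_mul (k + 1)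
  obtain ⟨C, hC0, hup⟩ := exists_hausdorffMeasure_le n (k + 1)
  obtain ⟨c₁, hc₁, η₁, hη₁, hlow⟩ := exists_le_hausdorffMeasure n k
  set θ : ℝ := 4 ^ (k + 1) / (1 + 4 ^ (k + 1)) with hθ
  have hθ0 : 0 ≤ θ := by positivity
  have hθ1 : θ < 1 := by rw [hθ, div_lt_one (by positivity)]; linarith
  set b : ℝ := c₁ * (1 / 4) ^ (k + 1) with hb
  have hb0 : 0 < b := by positivity
  obtain ⟨N, hN2, hN⟩ : ∃ N : ℕ, 2 ≤ N ∧ θ ^ N * (C * 2 ^ (k + 1)) ≤ b / 4 := by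
    have hlim : Tendsto (fun N : ℕ => θ ^ N * (C * 2 ^ (k + 1))) atTop (𝓝 0) := by
      simpa using (tendsto_pow_atTop_nhds_zero_of_lt_one hθ0 hθ1).mul_const (C * 2 ^ (k + 1))
    obtain ⟨N, h1, h2⟩ := ((hlim.eventually (ge_mem_nhds (by positivity : 0 < b / 4))).and
      (eventually_ge_atTop 2)).exists
    exact ⟨N, h2, h1⟩
  have hNr : (2 : ℝ) ≤ N := by exact_mod_cast hN2
  set η : ℝ := min (b / 4) (min η₁ 1) with hη
  have hη0 : 0 < η := by positivity
  obtain ⟨r₀, hr₀, hgauge⟩ : ∃ r₀ : ℝ, 0 < r₀ ∧ ∀ ρ, 0 < ρ → ρ ≤ r₀ →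
      h ρ ≤ c * ENNReal.ofReal η := by
    have hpos : 0 < c * ENNReal.ofReal η :=
      ENNReal.mul_pos hc0 (by simpa using hη0)
    have h1 := hh.2.eventually (ge_mem_nhds hpos)
    obtain ⟨r₀, hr₀, h2⟩ := mem_nhdsGT_iff_exists_Ioc_subset.1 h1
    exact ⟨r₀, hr₀, fun ρ hρ hρ' => h2 ⟨hρ, hρ'⟩⟩
  refine ⟨τ / (8 * N), by positivity, r₀, hr₀, ?_⟩
  intro U E hE hcoral x hxE r hr hrr₀ hU P _ hxP hdim hflat z₀ ⟨hz₀P, hz₀⟩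
  by_contra hnot
  have hτ1 : τ < 1 := by
    have h1 : 0 < (1 - τ) * r := dist_nonneg.trans_lt hz₀
    by_contra! h2
    nlinarith
  have hmin : ∀ η' ≥ η, ∀ y ρ, 0 < ρ → ρ ≤ r → Metric.closedBall y ρ ⊆ U →
      AlmostMinIn (k + 1) (ENNReal.ofReal η') E y ρ := fun η' hη' y ρ hρ hρr hyU =>
    hE.almostMinIn hc0 hct (hc _) hρ hyU ((hgauge ρ hρ (hρr.trans hrr₀)).trans (by gcongr))
  have hfin : ∀ y ρ, Metric.closedBall y ρ ⊆ U →
      μH[((k + 1 : ℕ) : ℝ)] (E ∩ Metric.closedBall y ρ) < ∞ := fun y ρ hyU => by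
    have h1 := hE.locallyFinite _ (isCompact_closedBall y ρ) hyU
    rw [hc] at h1
    exact ENNReal.lt_top_of_mul_ne_top_right h1.ne hc0
  have hBr : Metric.closedBall x r ⊆ U :=
    (Metric.closedBall_subset_ball (by linarith)).trans hU
  set R : ℝ := τ * r / 2 with hR
  have hR0 : 0 < R := by positivity
  have hτr : 0 < τ * r := by positivity
  have hεR : τ / (8 * N) * r = R / (4 * N) := by rw [hR]; field_simp; ring
  have hεR8 : R / (4 * N) ≤ R / 8 := by gcongr; linarith
  -- the projection of the part of `E` that is used
  set K : Set (EuclideanSpace ℝ (Fin n)) := E ∩ Metric.closedBall x (r - R / 2) with hK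
  have hKr : Metric.closedBall x (r - R / 2) ⊆ Metric.ball x r :=
    Metric.closedBall_subset_ball (by linarith)
  have hKc : IsCompact K := hE.isCompact_inter_closedBall
    ((hKr.trans Metric.ball_subset_closedBall).trans hBr)
  have hπ := coe_orthogonalProjection_eq P hxP
  set π : EuclideanSpace ℝ (Fin n) → EuclideanSpace ℝ (Fin n) := fun y =>
    (orthogonalProjection P y : EuclideanSpace ℝ (Fin n)) with hπdef
  have hπc : Continuous π := by
    have : π = fun y => P.direction.starProjection (y - x) + x := funext hπ
    rw [this]; fun_prop
  have hxK : x ∈ π '' K := by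
    refine ⟨x, ⟨hxE, Metric.mem_closedBall_self (by nlinarith)⟩, ?_⟩
    exact orthogonalProjection_eq_self_iff.2 hxP
  have hz₀K : z₀ ∉ π '' K := fun ⟨y, hy, hyz⟩ => hnot ⟨y, ⟨hy.1, hKr hy.2⟩, hyz⟩
  obtain ⟨t, ht, hzK, _, ⟨y, hyK, rfl⟩, hyz⟩ := exists_lineMap_notMem_of_isCompact
    (hKc.image hπc) hz₀K hxK (show 0 < R / 8 by positivity)
  set z := AffineMap.lineMap (k := ℝ) z₀ x t with hz
  have hzP : z ∈ P := AffineMap.lineMap_mem t hz₀P hxP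
  have hzx : dist z x < (1 - τ) * r := by
    rw [hz, dist_lineMap_right, Real.norm_of_nonneg (by linarith [ht.2])]
    exact (mul_le_of_le_one_left dist_nonneg (by linarith [ht.1])).trans_lt hz₀
  have hball : ∀ s, Metric.closedBall z s ⊆ Metric.closedBall x (s + (1 - τ) * r) := fun s =>
    Metric.closedBall_subset_closedBall' (by linarith)
  have hzR : Metric.closedBall z R ⊆ Metric.closedBall x (r - R / 2) :=
    (hball R).trans (Metric.closedBall_subset_closedBall (by rw [hR]; linarith))
  have hzR2 : Metric.closedBall z (2 * R) ⊆ U :=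
    ((hball (2 * R)).trans (Metric.closedBall_subset_closedBall (by rw [hR]; linarith))).trans hBr
  have hzRU : Metric.closedBall z R ⊆ U :=
    (Metric.closedBall_subset_closedBall (by linarith)).trans hzR2
  have hπz := coe_orthogonalProjection_eq P hzP
  have hdistπ : ∀ y ∈ E ∩ Metric.ball x r, dist y (π y) ≤ R / (4 * N) := fun y hy => by
    rw [hπdef, dist_orthogonalProjection_eq_infDist, ← hεR]
    exact hflat y hy
  have hRr : 2 * R ≤ r := by rw [hR]; nlinarith
  -- the three estimates
  have h1 := toReal_le_of_hole (W := P.direction) (z := z) hdim hη0.le hR0 hN2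
    (hE.isCompact_inter_closedBall hzRU) (hfin z R hzRU)
    (hmin η le_rfl z R hR0 (by linarith) hzRU)
    (fun y hy => by
      have h2 := hdistπ y ⟨hy.1, hKr (hzR hy.2)⟩
      rw [dist_eq_norm] at h2
      have e : y - π y = y - z - P.direction.starProjection (y - z) := by
        rw [hπdef]; simp only [hπz]; abel
      rwa [e] at h2)
    (fun y hy h0 => hzK ⟨y, ⟨hy.1, hzR hy.2⟩, by
      rw [hπdef]; simp only [hπz, h0, zero_add]⟩)
  have h2 := hup E z (2 * R) (by positivity) (hE.isCompact_inter_closedBall hzR2) (hfin _ _ hzR2)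
    (fun ρ hρ hρR => hmin 1 ((min_le_right _ _).trans (min_le_right _ _)) z ρ hρ
      (hρR.trans hRr) ((Metric.closedBall_subset_closedBall hρR).trans hzR2))
  rw [mul_div_cancel_left₀ R two_ne_zero] at h2
  have hyz' : dist y z ≤ R / 4 := by
    have h3 := hdistπ y ⟨hyK.1, hKr hyK.2⟩
    have h4 := dist_triangle y (π y) z
    rw [dist_comm z] at hyz
    linarith
  have hyz2 : Metric.closedBall y (R / 4) ⊆ Metric.closedBall z (R / 2) :=
    Metric.closedBall_subset_closedBall' (by linarith)
  have hyU : Metric.closedBall y (R / 4) ⊆ U :=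
    (hyz2.trans (Metric.closedBall_subset_closedBall (by linarith))).trans hzRU
  have h3 := hlow E y (R / 4) (by positivity) (hE.isCompact_inter_closedBall hyU) (hfin _ _ hyU)
    (fun y' ρ hρ hρR hsub => hmin η₁ ((min_le_right _ _).trans (min_le_left _ _)) y' ρ hρ
      (by linarith) (hsub.trans hyU))
    (by
      have h4 := hcoral y hyK.1 (R / 4 / 2) (by positivity)
      rw [hc] at h4
      have h5 : 0 < μH[((k + 1 : ℕ) : ℝ)] (E ∩ Metric.ball y (R / 4 / 2)) :=
        pos_of_ne_zero fun h0 => by rw [h0, mul_zero] at h4; exact lt_irrefl _ h4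
      exact h5.trans_le (measure_mono
        (inter_subset_inter_right _ Metric.ball_subset_closedBall)))
  have h4 : (μH[((k + 1 : ℕ) : ℝ)] (E ∩ Metric.closedBall y (R / 4))).toReal ≤
      (μH[((k + 1 : ℕ) : ℝ)] (E ∩ Metric.closedBall z (R / 2))).toReal :=
    ENNReal.toReal_mono (hfin _ _
      ((Metric.closedBall_subset_closedBall (by linarith)).trans hzRU)).ne
      (measure_mono (inter_subset_inter_right _ hyz2))
  rw [← hθ] at h1
  have h5 : θ ^ N * (μH[((k + 1 : ℕ) : ℝ)] (E ∩ Metric.closedBall z R)).toReal ≤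
      b / 4 * R ^ (k + 1) := by
    calc _ ≤ θ ^ N * (C * (2 * R) ^ (k + 1)) := by gcongr
      _ = θ ^ N * (C * 2 ^ (k + 1)) * R ^ (k + 1) := by rw [mul_pow]; ring
      _ ≤ _ := by gcongr
  have h6 : η * R ^ (k + 1) ≤ b / 4 * R ^ (k + 1) := by gcongr; exact min_le_left _ _
  have h7 : c₁ * (R / 4) ^ (k + 1) = b * R ^ (k + 1) := by
    rw [hb, div_eq_mul_one_div, mul_pow]; ring
  have h8 : 0 < b * R ^ (k + 1) := by positivity
  linarith

theorem theorem4p35 (n d : ℕ) (h : ℝ → ℝ≥0∞) (hh : IsGauge h) (τ : ℝ) (hτ : 0 < τ) :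
    ∃ ε : ℝ, 0 < ε ∧ ∃ r₀ : ℝ, 0 < r₀ ∧
      ∀ U E : Set (EuclideanSpace ℝ (Fin n)),
        IsOpen U → IsAlmostMinimal d U h E → IsCoral d E →
        ∀ x ∈ E, ∀ r : ℝ, 0 < r → r ≤ r₀ → Metric.ball x (2 * r) ⊆ U →
        ∀ (P : AffineSubspace ℝ (EuclideanSpace ℝ (Fin n))) [Nonempty P],
          x ∈ P → Module.finrank ℝ P.direction = d →
          (∀ y ∈ E ∩ Metric.ball x r,
            Metric.infDist y (P : Set (EuclideanSpace ℝ (Fin n))) ≤ ε * r) →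
          (P : Set (EuclideanSpace ℝ (Fin n))) ∩ Metric.ball x ((1 - τ) * r) ⊆
            (fun y => (EuclideanGeometry.orthogonalProjection P y : EuclideanSpace ℝ (Fin n))) ''
              (E ∩ Metric.ball x r) := by
  rcases d with _ | k
  · -- a `0`-plane through `x` is `{x}`
    refine ⟨1, one_pos, 1, one_pos, ?_⟩
    intro U E _ _ _ x hxE r hr _ _ P _ hxP hdim _ z ⟨hzP, _⟩
    have h0 : P.direction = ⊥ := Submodule.finrank_eq_zero.1 hdim
    have h1 : z -ᵥ x ∈ P.direction := AffineSubspace.vsub_mem_direction hzP hxP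
    rw [h0, Submodule.mem_bot, vsub_eq_zero_iff_eq] at h1
    exact ⟨x, ⟨hxE, Metric.mem_ball_self hr⟩,
      (EuclideanGeometry.orthogonalProjection_eq_self_iff.2 hxP).trans h1.symm⟩
  · obtain ⟨ε, hε, r₀, hr₀, H⟩ := exists_subset_image_orthogonalProjection n k hh hτ
    exact ⟨ε, hε, r₀, hr₀, fun U E _ => H U E⟩
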